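/- Let $R$ be a commutative ring (for example $\mathbb{Z}$ or a field). All operads are symmetric operads in $R$-modules; for an operad $\mathcal P$ with $\mathcal P(1)=R\cdot\mathrm{id}$, write $\mathcal P_+=(\mathcal P(k))_{k\ge 2}$. Ideals of operads are two-sided. The following operads are given by generators and relations. * $\operatorname{Dend}$: binary operations $\prec,\succ$ with $(x\prec y)\prec z=x\prec(y\prec z)+x\prec(y\succ z)$, $(x\succ y)\prec z=x\succ(y\prec z)$ and $x\succ(y\succ z)=(x\succ y)\succ z+(x\prec y)\succ z$. * $\operatorname{PreLie}$: a binary operation $\circ$ with $(x\circ y)\circ z-x\circ(y\circ z)=(x\circ z)\circ y-x\circ(z\circ y)$. * $\operatorname{Zin}$ (Zinbiel, or dual Leibniz, algebras): a binary operation $\cdot$ with $(x\cdot y)\cdot z=x\cdot(y\cdot z)+x\cdot(z\cdot y)$. * $\operatorname{Brace}$: operations $\{x_1\mid x_2,\dots,x_{n+1}\}$ in $n+1$ variables for all $n\ge 1$ (with the convention $\{x\mid\ \}=x$), subject for all $n,m\ge 1$ to $$\{\{z\mid x_1,\dots,x_n\}\mid y_1,\dots,y_m\}=\sum\{z\mid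 Y_0,\{x_1\mid Y_1\},Y_2,\{x_2\mid Y_3\},Y_4,\dots,Y_{2n-2},\{x_n\mid Y_{2n-1}\},Y_{2n}\},$$ the sum being over the partitions of the ordered set $\{y_1,\dots,y_m\}$ into successive, possibly empty, intervals $Y_0\sqcup\dots\sqcup Y_{2n}$. In $\operatorname{Dend}$ put $\nearrow(x_1)=\searrow(x_1)=x_1$, $\nearrow(x_1,\dots,x_n)=x_1\prec\nearrow(x_2,\dots,x_n)$ and $\searrow(x_1,\dots,x_{n+1})=\searrow(x_1,\dots,x_n)\succ x_{n+1}$. There is a unique morphism of operads $\alpha:\operatorname{PreLie}\to\operatorname{Dend}$ with $\alpha(x\circ y)=x\prec y-y\succ x$, and a unique morphism of operads $\psi:\operatorname{Brace}\to\operatorname{Dend}$ such that for all $n\ge1$ $$\psi(\{x_1\mid x_2,\dots,x_{n+1}\})=\sum_{i=1}^{n+1}(-1)^{i-1}\nearrow(x_2,\dots,x_i)\succ x_1\prec\searrow(x_{i+1},\dots,x_{n+1}),$$ where an operation with an empty list of arguments is omitted (the terms for $i=1$ and $i=n+1$ are $x_1\prec\searrow(x_2,\dots,x_{n+1})$ and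 $(-1)^n\nearrow(x_2,\dots,x_{n+1})\succ x_1$). **Proposition.** The images $\alpha(\operatorname{PreLie}_+)$ and $\psi(\operatorname{Brace}_+)$ generate the same ideal $\mathcal J$ of $\operatorname{Dend}$. The quotient operad $\operatorname{Dend}/\mathcal J$ is the operad $\operatorname{Zin}$: there is a unique isomorphism of operads $\operatorname{Dend}/\mathcal J\to\operatorname{Zin}$ that sends the class of $x\prec y$ to $x\cdot y$ and the class of $x\succ y$ to $y\cdot x$. -/

import Mathlib

universe u v w

noncomputable section

/-! ## Symmetric operads

Operads in `R`-modules are indexed by finite sets: the component `Obj I` is the module of operations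
whose inputs are labelled by the finite set `I`, bijections relabel the inputs (for `I = Fin n` this
is the action of the symmetric group), and the composition plugs a family of operations
`q k ∈ Obj (J k)` into the inputs `k ∈ K` of an operation `p ∈ Obj K`.  -/

/-- The bijection between `Unit × I` (as a sigma type) and `I`. -/
def unitSigma (I : Type) : (Σ _ : Unit, I) ≃ I where
  toFun x := x.2
  invFun x := ⟨(), x⟩
  left_inv _ := rfl
  right_inv _ := rfl

/-- Symmetric operads in the category of `R`-modules. -/
structure SymOperad (R : Type u) [CommRing R] where
  /-- operations with inputs labelled by `I` -/
  Obj : (I : Type) → [Finite I] → Type v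
  [instAddCommGroup : ∀ (I : Type) [Finite I], AddCommGroup (Obj I)]
  [instModule : ∀ (I : Type) [Finite I], Module R (Obj I)]
  /-- relabelling of the inputs -/
  map : ∀ {I J : Type} [Finite I] [Finite J], (I ≃ J) → Obj I →ₗ[R] Obj J
  /-- the identity operation -/
  one : Obj Unit
  /-- composition -/
  comp : ∀ {K : Type} [Finite K] {J : K → Type} [∀ k, Finite (J k)],
    Obj K →ₗ[R] MultilinearMap R (fun k => Obj (J k)) (Obj (Σ k, J k))
  map_refl : ∀ {I : Type} [Finite I] (p : Obj I), map (Equiv.refl I) p = p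
  map_trans : ∀ {I J L : Type} [Finite I] [Finite J] [Finite L] (e : I ≃ J) (f : J ≃ L) (p : Obj I),
    map (e.trans f) p = map f (map e p)
  comp_map_right : ∀ {K : Type} [Finite K] {J J' : K → Type} [∀ k, Finite (J k)]
    [∀ k, Finite (J' k)] (e : ∀ k, J k ≃ J' k) (p : Obj K) (q : ∀ k, Obj (J k)),
    comp p (fun k => map (e k) (q k)) = map (Equiv.sigmaCongrRight e) (comp p q)
  comp_map_left : ∀ {K K' : Type} [Finite K] [Finite K'] {J : K' → Type} [∀ k, Finite (J k)]
    (e : K ≃ K') (p : Obj K) (q : ∀ k, Obj (J k)),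
    comp (map e p) q = map (Equiv.sigmaCongrLeft e) (comp p (fun k => q (e k)))
  one_comp : ∀ {I : Type} [Finite I] (p : Obj I),
    map (unitSigma I) (comp one (fun _ => p)) = p
  comp_one : ∀ {I : Type} [Finite I] (p : Obj I),
    map (Equiv.sigmaPUnit I) (comp p (fun _ => one)) = p
  comp_assoc : ∀ {K : Type} [Finite K] {J : K → Type} [∀ k, Finite (J k)]
    {L : ∀ k, J k → Type} [∀ k j, Finite (L k j)]
    (p : Obj K) (q : ∀ k, Obj (J k)) (r : ∀ k j, Obj (L k j)),
    map (Equiv.sigmaAssoc L) (comp (comp p q) (fun x => r x.1 x.2)) =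
      comp p (fun k => comp (q k) (r k))

attribute [instance] SymOperad.instAddCommGroup SymOperad.instModule

namespace SymOperad

variable {R : Type u} [CommRing R]

/-- Morphisms of operads. -/
@[ext]
structure Hom (P : SymOperad.{u, v} R) (Q : SymOperad.{u, w} R) where
  app : ∀ (I : Type) [Finite I], P.Obj I →ₗ[R] Q.Obj I
  app_map : ∀ {I J : Type} [Finite I] [Finite J] (e : I ≃ J) (p : P.Obj I),
    app J (P.map e p) = Q.map e (app I p)
  app_one : app Unit P.one = Q.one
  app_comp : ∀ {K : Type} [Finite K] {J : K → Type} [∀ k, Finite (J k)]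
    (p : P.Obj K) (q : ∀ k, P.Obj (J k)),
    app (Σ k, J k) (P.comp p q) = Q.comp (app K p) (fun k => app (J k) (q k))

/-- Isomorphisms of operads: pairs of mutually inverse morphisms. -/
@[ext]
structure Iso (P : SymOperad.{u, v} R) (Q : SymOperad.{u, w} R) where
  hom : Hom P Q
  inv : Hom Q P
  inv_hom : ∀ (I : Type) [Finite I] (p : P.Obj I), inv.app I (hom.app I p) = p
  hom_inv : ∀ (I : Type) [Finite I] (q : Q.Obj I), hom.app I (inv.app I q) = q

/-- Two-sided operad ideals. -/
@[ext]
structure OpIdeal (P : SymOperad.{u, v} R) where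
  carrier : ∀ (I : Type) [Finite I], Submodule R (P.Obj I)
  map_mem : ∀ {I J : Type} [Finite I] [Finite J] (e : I ≃ J) (p : P.Obj I),
    p ∈ carrier I → P.map e p ∈ carrier J
  comp_mem_left : ∀ {K : Type} [Finite K] {J : K → Type} [∀ k, Finite (J k)]
    (p : P.Obj K) (q : ∀ k, P.Obj (J k)), p ∈ carrier K → P.comp p q ∈ carrier (Σ k, J k)
  comp_mem_right : ∀ {K : Type} [Finite K] {J : K → Type} [∀ k, Finite (J k)]
    (p : P.Obj K) (q : ∀ k, P.Obj (J k)) (k : K), q k ∈ carrier (J k) →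
    P.comp p q ∈ carrier (Σ k, J k)

/-- The ideal generated by a set of operations: the smallest ideal containing it. -/
def idealSpan (P : SymOperad.{u, v} R) (S : ∀ (I : Type) [Finite I], P.Obj I → Prop) :
    OpIdeal P where
  carrier I _ := ⨅ (T : OpIdeal P) (_ : ∀ (I : Type) [Finite I] (p : P.Obj I),
    S I p → p ∈ T.carrier I), T.carrier I
  map_mem e p hp := by
    simp only [Submodule.mem_iInf] at hp ⊢
    exact fun T hT => T.map_mem e p (hp T hT)
  comp_mem_left p q hp := by
    simp only [Submodule.mem_iInf] at hp ⊢
    exact fun T hT => T.comp_mem_left p q (hp T hT)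
  comp_mem_right p q k hq := by
    simp only [Submodule.mem_iInf] at hq ⊢
    exact fun T hT => T.comp_mem_right p q k (hq T hT)

/-! ### Quotient operads -/

theorem OpIdeal.comp_sub_mem {P : SymOperad.{u, v} R} (T : OpIdeal P) {K : Type} [Finite K]
    {J : K → Type} [∀ k, Finite (J k)] (p p' : P.Obj K) (q q' : ∀ k, P.Obj (J k))
    (hp : p - p' ∈ T.carrier K) (hq : ∀ k, q k - q' k ∈ T.carrier (J k)) :
    P.comp p q - P.comp p' q' ∈ T.carrier (Σ k, J k) := by
  classical
  cases nonempty_fintype K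
  have h1 : P.comp p q - P.comp p' q ∈ T.carrier (Σ k, J k) := by
    have := T.comp_mem_left (p - p') q hp
    rwa [map_sub, sub_apply] at this
  have h2 : ∀ s : Finset K,
      P.comp p' q - P.comp p' (s.piecewise q' q) ∈ T.carrier (Σ k, J k) := by
    intro s
    induction s using Finset.induction_on with
    | empty => simp
    | insert a s ha ih =>
      have h3 := T.comp_mem_right p'
        (Function.update (s.piecewise q' q) a (q a - q' a)) a (by simpa using hq a)
      rw [MultilinearMap.map_update_sub] at h3
      have h4 : Function.update (s.piecewise q' q) a (q a) = s.piecewise q' q := by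
        rw [Function.update_eq_self_iff, Finset.piecewise_eq_of_notMem _ _ _ ha]
      rw [h4, ← Finset.piecewise_insert] at h3
      simpa using add_mem ih h3
  have h5 := h2 Finset.univ
  rw [Finset.piecewise_univ] at h5
  simpa using add_mem h1 h5

/-- A chosen representative of a class in the quotient. -/
def OpIdeal.rep {P : SymOperad.{u, v} R} (T : OpIdeal P) {I : Type} [Finite I]
    (x : P.Obj I ⧸ T.carrier I) : P.Obj I :=
  (Submodule.Quotient.mk_surjective (T.carrier I) x).choose

theorem OpIdeal.mk_rep {P : SymOperad.{u, v} R} (T : OpIdeal P) {I : Type} [Finite I]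
    (x : P.Obj I ⧸ T.carrier I) : Submodule.Quotient.mk (T.rep x) = x :=
  (Submodule.Quotient.mk_surjective (T.carrier I) x).choose_spec

theorem OpIdeal.mk_comp_congr {P : SymOperad.{u, v} R} (T : OpIdeal P) {K : Type} [Finite K]
    {J : K → Type} [∀ k, Finite (J k)] {p p' : P.Obj K} {q q' : ∀ k, P.Obj (J k)}
    (hp : (Submodule.Quotient.mk p : P.Obj K ⧸ T.carrier K) = Submodule.Quotient.mk p')
    (hq : ∀ k, (Submodule.Quotient.mk (q k) : P.Obj (J k) ⧸ T.carrier (J k)) =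
      Submodule.Quotient.mk (q' k)) :
    (Submodule.Quotient.mk (P.comp p q) : P.Obj (Σ k, J k) ⧸ T.carrier (Σ k, J k)) =
      Submodule.Quotient.mk (P.comp p' q') :=
  (Submodule.Quotient.eq _).2 (T.comp_sub_mem p p' q q' ((Submodule.Quotient.eq _).1 hp)
    fun k => (Submodule.Quotient.eq _).1 (hq k))

/-- The composition induced on the quotient by an ideal. -/
def OpIdeal.quotComp {P : SymOperad.{u, v} R} (T : OpIdeal P) {K : Type} [Finite K]
    {J : K → Type} [∀ k, Finite (J k)] :
    (P.Obj K ⧸ T.carrier K) →ₗ[R] MultilinearMap R (fun k => P.Obj (J k) ⧸ T.carrier (J k))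
      (P.Obj (Σ k, J k) ⧸ T.carrier (Σ k, J k)) where
  toFun x :=
    { toFun := fun y => Submodule.Quotient.mk (P.comp (T.rep x) (fun k => T.rep (y k)))
      map_update_add' := by
        intro _ m k a b
        have key : ∀ c : P.Obj (J k) ⧸ T.carrier (J k), ∀ c' : P.Obj (J k),
            Submodule.Quotient.mk c' = c →
            (Submodule.Quotient.mk (P.comp (T.rep x) (fun i => T.rep (Function.update m k c i))) :
              P.Obj (Σ k, J k) ⧸ T.carrier (Σ k, J k)) =
            Submodule.Quotient.mk
              (P.comp (T.rep x) (Function.update (fun i => T.rep (m i)) k c')) := by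
          intro c c' hc
          refine T.mk_comp_congr rfl fun i => ?_
          by_cases h : i = k
          · subst h; simp [T.mk_rep, hc]
          · simp [h]
        rw [key (a + b) (T.rep a + T.rep b) (by simp [T.mk_rep]), key a (T.rep a) (T.mk_rep a),
          key b (T.rep b) (T.mk_rep b), MultilinearMap.map_update_add, Submodule.Quotient.mk_add]
      map_update_smul' := by
        intro _ m k c a
        have key : ∀ c : P.Obj (J k) ⧸ T.carrier (J k), ∀ c' : P.Obj (J k),
            Submodule.Quotient.mk c' = c →
            (Submodule.Quotient.mk (P.comp (T.rep x) (fun i => T.rep (Function.update m k c i))) :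
              P.Obj (Σ k, J k) ⧸ T.carrier (Σ k, J k)) =
            Submodule.Quotient.mk
              (P.comp (T.rep x) (Function.update (fun i => T.rep (m i)) k c')) := by
          intro c c' hc
          refine T.mk_comp_congr rfl fun i => ?_
          by_cases h : i = k
          · subst h; simp [T.mk_rep, hc]
          · simp [h]
        rw [key (c • a) (c • T.rep a) (by simp [T.mk_rep]), key a (T.rep a) (T.mk_rep a),
          MultilinearMap.map_update_smul, Submodule.Quotient.mk_smul] }
  map_add' x x' := by
    ext y
    rw [add_apply]
    simp only [MultilinearMap.coe_mk]
    rw [← Submodule.Quotient.mk_add, ← add_apply, ← map_add]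
    exact T.mk_comp_congr (by simp [T.mk_rep]) fun _ => rfl
  map_smul' c x := by
    ext y
    rw [RingHom.id_apply, smul_apply]
    simp only [MultilinearMap.coe_mk]
    rw [← Submodule.Quotient.mk_smul, ← smul_apply, ← map_smul]
    exact T.mk_comp_congr (by simp [T.mk_rep]) fun _ => rfl

theorem OpIdeal.quotComp_mk {P : SymOperad.{u, v} R} (T : OpIdeal P) {K : Type} [Finite K]
    {J : K → Type} [∀ k, Finite (J k)] (p : P.Obj K) (q : ∀ k, P.Obj (J k)) :
    T.quotComp (Submodule.Quotient.mk p) (fun k => Submodule.Quotient.mk (q k)) =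
      Submodule.Quotient.mk (P.comp p q) :=
  T.mk_comp_congr (T.mk_rep _) fun _ => T.mk_rep _

/-- The quotient of an operad by an ideal. -/
def quot (P : SymOperad.{u, v} R) (T : OpIdeal P) : SymOperad.{u, v} R where
  Obj I _ := P.Obj I ⧸ T.carrier I
  map {I J} _ _ e := (T.carrier I).mapQ (T.carrier J) (P.map e) fun p hp => T.map_mem e p hp
  one := Submodule.Quotient.mk P.one
  comp := T.quotComp
  map_refl p := by
    obtain ⟨p, rfl⟩ := Submodule.Quotient.mk_surjective _ p
    exact congrArg _ (P.map_refl p)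
  map_trans e f p := by
    obtain ⟨p, rfl⟩ := Submodule.Quotient.mk_surjective _ p
    exact congrArg _ (P.map_trans e f p)
  comp_map_right e p q := by
    obtain ⟨p, rfl⟩ := Submodule.Quotient.mk_surjective _ p
    obtain ⟨q, rfl⟩ : ∃ q' : ∀ k, P.Obj _, q = fun k => Submodule.Quotient.mk (q' k) :=
      ⟨fun k => T.rep (q k), funext fun k => (T.mk_rep _).symm⟩
    simp only [Submodule.mapQ_apply, T.quotComp_mk, P.comp_map_right]
  comp_map_left e p q := by
    obtain ⟨p, rfl⟩ := Submodule.Quotient.mk_surjective _ p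
    obtain ⟨q, rfl⟩ : ∃ q' : ∀ k, P.Obj _, q = fun k => Submodule.Quotient.mk (q' k) :=
      ⟨fun k => T.rep (q k), funext fun k => (T.mk_rep _).symm⟩
    simp only [Submodule.mapQ_apply, T.quotComp_mk, P.comp_map_left]
  one_comp p := by
    obtain ⟨p, rfl⟩ := Submodule.Quotient.mk_surjective _ p
    simp only [Submodule.mapQ_apply, T.quotComp_mk, P.one_comp]
  comp_one p := by
    obtain ⟨p, rfl⟩ := Submodule.Quotient.mk_surjective _ p
    simp only [Submodule.mapQ_apply, T.quotComp_mk, P.comp_one]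
  comp_assoc p q r := by
    obtain ⟨p, rfl⟩ := Submodule.Quotient.mk_surjective _ p
    obtain ⟨q, rfl⟩ : ∃ q' : ∀ k, P.Obj _, q = fun k => Submodule.Quotient.mk (q' k) :=
      ⟨fun k => T.rep (q k), funext fun k => (T.mk_rep _).symm⟩
    obtain ⟨r, rfl⟩ : ∃ r' : ∀ k j, P.Obj _, r = fun k j => Submodule.Quotient.mk (r' k j) :=
      ⟨fun k j => T.rep (r k j), funext fun k => funext fun j => (T.mk_rep _).symm⟩
    simp only [T.quotComp_mk, Submodule.mapQ_apply, P.comp_assoc]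

/-- The class of an operation in the quotient operad. -/
def quotMk {P : SymOperad.{u, v} R} (T : OpIdeal P) {I : Type} [Finite I] (p : P.Obj I) :
    (P.quot T).Obj I :=
  (Submodule.Quotient.mk p : P.Obj I ⧸ T.carrier I)

end SymOperad

/-! ## Trees and free operads -/

/-- Formal composites of the generators in `E` (where `E k` is the type of generators with `k`
inputs), with leaves labelled in `X`. -/
inductive OpTree (E : ℕ → Type) (X : Type) : Type
  | leaf (x : X) : OpTree E X
  | node {k : ℕ} (g : E k) (c : Fin k → OpTree E X) : OpTree E X

namespace OpTree

variable {E : ℕ → Type} {X Y Z : Type}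

/-- The list of the labels of the leaves, from left to right. -/
def leaves : OpTree E X → List X
  | leaf x => [x]
  | node _ c => (List.ofFn fun i => (c i).leaves).flatten

/-- Substitution of trees for the leaves. -/
def bind : OpTree E X → (X → OpTree E Y) → OpTree E Y
  | leaf x, f => f x
  | node g c, f => node g fun i => (c i).bind f

theorem bind_bind (t : OpTree E X) (f : X → OpTree E Y) (g : Y → OpTree E Z) :
    (t.bind f).bind g = t.bind fun x => (f x).bind g := by
  induction t with
  | leaf x => rfl
  | node h c ih => simp only [bind, ih]

theorem bind_leaf (t : OpTree E X) : t.bind leaf = t := by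
  induction t with
  | leaf x => rfl
  | node h c ih => simp only [bind, ih]

theorem leaves_bind (t : OpTree E X) (f : X → OpTree E Y) :
    (t.bind f).leaves = t.leaves.flatMap fun x => (f x).leaves := by
  induction t with
  | leaf x => simp [bind, leaves]
  | node h c ih =>
    simp only [bind, leaves, ih]
    rw [List.flatMap_def, List.map_flatten, List.flatten_flatten, List.map_map, List.map_ofFn]
    rfl

/-- Every label occurs exactly once. -/
def Linear (t : OpTree E X) : Prop := t.leaves.Nodup ∧ ∀ x, x ∈ t.leaves

theorem leaves_bind_leaf (t : OpTree E X) (f : X → Y) :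
    (t.bind fun x => leaf (f x)).leaves = t.leaves.map f := by
  rw [leaves_bind, List.map_eq_flatMap]
  rfl

theorem Linear.map {t : OpTree E X} (ht : t.Linear) (e : X ≃ Y) :
    (t.bind fun x => leaf (e x)).Linear := by
  rw [Linear, leaves_bind_leaf]
  exact ⟨ht.1.map e.injective, fun y => List.mem_map.2 ⟨e.symm y, ht.2 _, e.apply_symm_apply y⟩⟩

theorem Linear.graft {J : X → Type} {t : OpTree E X} (ht : t.Linear) {s : ∀ x, OpTree E (J x)}
    (hs : ∀ x, (s x).Linear) :
    (t.bind fun x => (s x).bind fun j => leaf (Sigma.mk x j)).Linear := by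
  have h : (t.bind fun x => (s x).bind fun j => leaf (Sigma.mk x j)).leaves =
      t.leaves.sigma fun x => (s x).leaves := by
    rw [leaves_bind]
    simp only [leaves_bind_leaf]
    rfl
  rw [Linear, h]
  exact ⟨ht.1.sigma fun x => (hs x).1, fun ⟨x, j⟩ => List.mem_sigma.2 ⟨ht.2 x, (hs x).2 j⟩⟩

end OpTree

/-- Trees whose leaves are in bijection with `I`. -/
def LinTree (E : ℕ → Type) (I : Type) : Type := {t : OpTree E I // t.Linear}

namespace LinTree

variable {E : ℕ → Type}

/-- Relabelling of the leaves. -/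
def map {I J : Type} (e : I ≃ J) (t : LinTree E I) : LinTree E J := ⟨_, t.2.map e⟩

/-- Grafting the trees `s k` on the leaves `k` of `t`. -/
def graft {K : Type} {J : K → Type} (t : LinTree E K) (s : ∀ k, LinTree E (J k)) :
    LinTree E (Σ k, J k) := ⟨_, t.2.graft fun k => (s k).2⟩

theorem map_refl {I : Type} (t : LinTree E I) : t.map (Equiv.refl I) = t :=
  Subtype.ext (OpTree.bind_leaf _)

theorem map_trans {I J L : Type} (e : I ≃ J) (f : J ≃ L) (t : LinTree E I) :
    t.map (e.trans f) = (t.map e).map f :=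
  Subtype.ext (by simp only [map, OpTree.bind_bind, OpTree.bind]; rfl)

theorem graft_map_right {K : Type} {J J' : K → Type} (e : ∀ k, J k ≃ J' k) (t : LinTree E K)
    (s : ∀ k, LinTree E (J k)) :
    t.graft (fun k => (s k).map (e k)) = (t.graft s).map (Equiv.sigmaCongrRight e) :=
  Subtype.ext (by simp only [map, graft, OpTree.bind_bind, OpTree.bind]; rfl)

theorem graft_map_left {K K' : Type} {J : K' → Type} (e : K ≃ K') (t : LinTree E K)
    (s : ∀ k, LinTree E (J k)) :
    (t.map e).graft s = (t.graft fun k => s (e k)).map (Equiv.sigmaCongrLeft e) :=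
  Subtype.ext (by simp only [map, graft, OpTree.bind_bind, OpTree.bind]; rfl)

/-- The tree reduced to one leaf. -/
def one : LinTree E Unit :=
  ⟨OpTree.leaf (), by simp [OpTree.Linear, OpTree.leaves]⟩

theorem one_graft {I : Type} (t : LinTree E I) :
    ((one (E := E)).graft fun _ => t).map (unitSigma I) = t :=
  Subtype.ext (by
    simp only [map, graft, one, OpTree.bind_bind, OpTree.bind]
    exact OpTree.bind_leaf _)

theorem graft_one {I : Type} (t : LinTree E I) :
    (t.graft fun _ => one).map (Equiv.sigmaPUnit I) = t :=
  Subtype.ext (by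
    simp only [map, graft, one, OpTree.bind_bind, OpTree.bind]
    exact OpTree.bind_leaf _)

theorem graft_assoc {K : Type} {J : K → Type} {L : ∀ k, J k → Type} (t : LinTree E K)
    (s : ∀ k, LinTree E (J k)) (r : ∀ k j, LinTree E (L k j)) :
    ((t.graft s).graft fun x => r x.1 x.2).map (Equiv.sigmaAssoc L) =
      t.graft fun k => (s k).graft (r k) :=
  Subtype.ext (by simp only [map, graft, OpTree.bind_bind, OpTree.bind]; rfl)

end LinTree

/-- The multilinear map sending a family of formal sums to the formal sum of families. -/
def finsuppProd (R : Type u) [CommRing R] {K : Type} [Finite K] (α : K → Type) :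
    MultilinearMap R (fun k => α k →₀ R) ((∀ k, α k) →₀ R) :=
  haveI := Fintype.ofFinite K
  haveI := Classical.decEq K
  { toFun := fun q => Finsupp.onFinset (Fintype.piFinset fun k => (q k).support)
      (fun s => ∏ k, q k (s k)) (fun s hs => by
        rw [Fintype.mem_piFinset]
        intro k
        rw [Finsupp.mem_support_iff]
        intro h
        exact hs (Finset.prod_eq_zero (Finset.mem_univ k) h))
    map_update_add' := by
      intro _ m k a b
      ext s
      have h : ∀ c : α k →₀ R, ∏ i, (Function.update m k c i) (s i) =
          c (s k) * ∏ i ∈ Finset.univ.erase k, m i (s i) := by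
        intro c
        rw [← Finset.mul_prod_erase _ _ (Finset.mem_univ k), Function.update_self]
        congr 1
        refine Finset.prod_congr rfl fun i hi => ?_
        rw [Function.update_of_ne (Finset.ne_of_mem_erase hi)]
      simp only [Finsupp.onFinset_apply, Finsupp.add_apply, h, add_mul]
    map_update_smul' := by
      intro _ m k c a
      ext s
      have h : ∀ c : α k →₀ R, ∏ i, (Function.update m k c i) (s i) =
          c (s k) * ∏ i ∈ Finset.univ.erase k, m i (s i) := by
        intro c
        rw [← Finset.mul_prod_erase _ _ (Finset.mem_univ k), Function.update_self]
        congr 1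
        refine Finset.prod_congr rfl fun i hi => ?_
        rw [Function.update_of_ne (Finset.ne_of_mem_erase hi)]
      simp only [Finsupp.onFinset_apply, Finsupp.smul_apply, h, smul_eq_mul, mul_assoc] }

theorem finsuppProd_apply (R : Type u) [CommRing R] {K : Type} [Fintype K] {α : K → Type}
    (q : ∀ k, α k →₀ R) (s : ∀ k, α k) : finsuppProd R α q s = ∏ k, q k (s k) :=
  Finset.prod_congr (Finset.ext fun _ => by simp) fun _ _ => rfl

theorem finsuppProd_single (R : Type u) [CommRing R] {K : Type} [Finite K] {α : K → Type}
    (s : ∀ k, α k) :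
    finsuppProd R α (fun k => Finsupp.single (s k) 1) = Finsupp.single s 1 := by
  classical
  cases nonempty_fintype K
  ext s'
  rw [finsuppProd_apply]
  by_cases h : s = s'
  · subst h; simp
  · obtain ⟨k, hk⟩ := Function.ne_iff.1 h
    rw [Finsupp.single_eq_of_ne (Ne.symm h)]
    exact Finset.prod_eq_zero (Finset.mem_univ k) (Finsupp.single_eq_of_ne (Ne.symm hk))

theorem finsuppProd_mapDomain (R : Type u) [CommRing R] {K : Type} [Finite K] {α β : K → Type}
    (f : ∀ k, α k → β k) (q : ∀ k, α k →₀ R) :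
    finsuppProd R β (fun k => Finsupp.mapDomain (f k) (q k)) =
      Finsupp.mapDomain (fun s k => f k (s k)) (finsuppProd R α q) := by
  have h : (finsuppProd R β).compLinearMap (fun k => Finsupp.lmapDomain R R (f k)) =
      (Finsupp.lmapDomain R R fun (s : ∀ k, α k) k => f k (s k)).compMultilinearMap
        (finsuppProd R α) := by
    refine Module.Basis.ext_multilinear (fun k => Finsupp.basisSingleOne) fun s => ?_
    simp only [Finsupp.coe_basisSingleOne, MultilinearMap.compLinearMap_apply,
      LinearMap.compMultilinearMap_apply, Finsupp.lmapDomain_apply, Finsupp.mapDomain_single,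
      finsuppProd_single]
  exact congrArg (fun g => g q) h

theorem finsuppProd_finsuppProd (R : Type u) [CommRing R] {K : Type} [Finite K] {J : K → Type}
    [∀ k, Finite (J k)] {α : ∀ k, J k → Type} (r : ∀ k j, α k j →₀ R) :
    finsuppProd R (fun k => ∀ j, α k j) (fun k => finsuppProd R (α k) (r k)) =
      Finsupp.mapDomain (fun s k j => s ⟨k, j⟩)
        (finsuppProd R (fun x : Σ k, J k => α x.1 x.2) (fun x => r x.1 x.2)) := by
  classical
  cases nonempty_fintype K
  have := fun k => Fintype.ofFinite (J k)
  ext s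
  have hinj : Function.Injective
      (fun (s : ∀ x : Σ k, J k, α x.1 x.2) (k : K) (j : J k) => s ⟨k, j⟩) := by
    intro a b hab
    funext x
    exact congrFun (congrFun hab x.1) x.2
  refine Eq.trans ?_ (Finsupp.mapDomain_apply hinj _ fun x : Σ k, J k => s x.1 x.2).symm
  simp only [finsuppProd_apply, Fintype.prod_sigma]

/-- Composition in the free operad: the multilinear extension of the grafting of trees. -/
def freeComp (R : Type u) [CommRing R] (E : ℕ → Type) {K : Type} [Finite K] {J : K → Type} :
    (LinTree E K →₀ R) →ₗ[R]
      MultilinearMap R (fun k => LinTree E (J k) →₀ R) (LinTree E (Σ k, J k) →₀ R) :=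
  Finsupp.linearCombination R fun t =>
    (Finsupp.lmapDomain R R (LinTree.graft t)).compMultilinearMap
      (finsuppProd R fun k => LinTree E (J k))

theorem freeComp_single (R : Type u) [CommRing R] (E : ℕ → Type) {K : Type} [Finite K]
    {J : K → Type} (t : LinTree E K) (a : R) (q : ∀ k, LinTree E (J k) →₀ R) :
    freeComp R E (Finsupp.single t a) q =
      a • Finsupp.mapDomain t.graft (finsuppProd R (fun k => LinTree E (J k)) q) := by
  simp [freeComp]

/-- The free operad on `k`-ary generators `E k`, without symmetries: formal linear combinations of
trees whose leaves are in bijection with the inputs. -/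
def freeOperad (R : Type u) [CommRing R] (E : ℕ → Type) : SymOperad.{u, u} R where
  Obj I _ := LinTree E I →₀ R
  map e := Finsupp.lmapDomain R R (LinTree.map e)
  one := Finsupp.single LinTree.one 1
  comp := freeComp R E
  map_refl {I _} p := by
    have h : LinTree.map (E := E) (Equiv.refl I) = id := funext LinTree.map_refl
    rw [Finsupp.lmapDomain_apply, h, Finsupp.mapDomain_id]
  map_trans e f p := by
    have h : LinTree.map (E := E) (e.trans f) = LinTree.map f ∘ LinTree.map e :=
      funext (LinTree.map_trans e f)
    simp only [Finsupp.lmapDomain_apply, h, Finsupp.mapDomain_comp]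
  comp_map_right e p q := by
    induction p using Finsupp.induction_linear with
    | zero => simp
    | add a b ha hb => simp only [map_add, add_apply, ha, hb]
    | single t a =>
      simp only [freeComp_single, Finsupp.lmapDomain_apply, Finsupp.mapDomain_smul,
        finsuppProd_mapDomain, ← Finsupp.mapDomain_comp]
      congr 2
      funext s
      exact LinTree.graft_map_right e t s
  comp_map_left {K K' _ _ J _} e p q := by
    induction p using Finsupp.induction_linear with
    | zero => simp
    | add a b ha hb => simp only [map_add, add_apply, ha, hb]
    | single t a =>
      have h : finsuppProd R (fun k => LinTree E (J (e k))) (fun k => q (e k)) =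
          Finsupp.mapDomain (fun s k => s (e k)) (finsuppProd R (fun k => LinTree E (J k)) q) := by
        cases nonempty_fintype K
        cases nonempty_fintype K'
        have hinj : Function.Injective (fun (s : ∀ k, LinTree E (J k)) (k : K) => s (e k)) := by
          intro a b hab
          funext x
          obtain ⟨k, rfl⟩ := e.surjective x
          exact congrFun hab k
        ext s
        obtain ⟨s, rfl⟩ : ∃ s' : ∀ k, LinTree E (J k), s = fun k => s' (e k) :=
          ⟨Equiv.piCongrLeft (fun k => LinTree E (J k)) e s, by
            funext k; exact (Equiv.piCongrLeft_apply_apply (fun k => LinTree E (J k)) e s k).symm⟩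
        refine Eq.trans ?_ (Finsupp.mapDomain_apply hinj _ s).symm
        simp only [finsuppProd_apply]
        exact Equiv.prod_comp e fun k => q k (s k)
      simp only [freeComp_single, Finsupp.lmapDomain_apply, Finsupp.mapDomain_single,
        Finsupp.mapDomain_smul, h, ← Finsupp.mapDomain_comp]
      congr 2
      funext s
      exact LinTree.graft_map_left e t s
  one_comp {I _} p := by
    have h : finsuppProd R (fun _ : Unit => LinTree E I) (fun _ => p) =
        Finsupp.mapDomain (fun t _ => t) p := by
      ext s
      have hinj : Function.Injective (fun (t : LinTree E I) (_ : Unit) => t) :=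
        fun a b hab => congrFun hab ()
      refine Eq.trans ?_ (Finsupp.mapDomain_apply hinj p (s ())).symm
      simp [finsuppProd_apply]
    rw [freeComp_single, h, one_smul, Finsupp.lmapDomain_apply, ← Finsupp.mapDomain_comp,
      ← Finsupp.mapDomain_comp]
    refine Eq.trans (congrArg (fun f => Finsupp.mapDomain f p) ?_) Finsupp.mapDomain_id
    funext t
    exact LinTree.one_graft t
  comp_one p := by
    induction p using Finsupp.induction_linear with
    | zero => simp
    | add a b ha hb => simp only [map_add, add_apply, ha, hb]
    | single t a =>
      rw [freeComp_single, finsuppProd_single R (fun _ => LinTree.one)]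
      simp only [Finsupp.mapDomain_single, Finsupp.lmapDomain_apply,
        LinTree.graft_one, Finsupp.smul_single, smul_eq_mul, mul_one]
  comp_assoc {K _ J _ L _} p q r := by
    induction p using Finsupp.induction_linear with
    | zero => simp
    | add a b ha hb => simp only [map_add, add_apply, ha, hb]
    | single t a =>
      let ev : ∀ {A : Type} [Finite A] {B : A → Type} (_ : ∀ i, LinTree E (B i) →₀ R),
          (LinTree E A →₀ R) →ₗ[R] (LinTree E (Σ i, B i) →₀ R) := fun y =>
        { toFun := fun x => freeComp R E x y
          map_add' := fun _ _ => by rw [map_add]; rfl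
          map_smul' := fun _ _ => by rw [map_smul]; rfl }
      have h : (Finsupp.lmapDomain R R (LinTree.map (Equiv.sigmaAssoc L)) ∘ₗ
            ev (A := Σ k, J k) (fun x => r x.1 x.2)).compMultilinearMap
            (freeComp R E (Finsupp.single t a)) =
          (freeComp R E (Finsupp.single t a)).compLinearMap (fun k => ev (r k)) := by
        refine Module.Basis.ext_multilinear (fun k => Finsupp.basisSingleOne) fun s => ?_
        simp only [Finsupp.coe_basisSingleOne, MultilinearMap.compLinearMap_apply,
          LinearMap.compMultilinearMap_apply, LinearMap.comp_apply, ev, LinearMap.coe_mk,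
          AddHom.coe_mk, freeComp_single, finsuppProd_single, Finsupp.mapDomain_single,
          Finsupp.smul_single, smul_eq_mul, mul_one, one_smul, finsuppProd_mapDomain,
          finsuppProd_finsuppProd, Finsupp.lmapDomain_apply, Finsupp.mapDomain_smul,
          ← Finsupp.mapDomain_comp]
        congr 2
        funext u
        exact LinTree.graft_assoc t s fun k j => u ⟨k, j⟩
      exact congrArg (fun g => g q) h

/-- A tree as an element of the free operad. -/
def freeOf (R : Type u) [CommRing R] {E : ℕ → Type} {I : Type} [Finite I] (t : OpTree E I)
    (ht : t.Linear) : (freeOperad R E).Obj I :=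
  (Finsupp.single (⟨t, ht⟩ : LinTree E I) 1 : LinTree E I →₀ R)

/-- The operad presented by generators `E` and relations `S`. -/
def presented (R : Type u) [CommRing R] (E : ℕ → Type)
    (S : ∀ (I : Type) [Finite I], (freeOperad R E).Obj I → Prop) : SymOperad.{u, u} R :=
  (freeOperad R E).quot ((freeOperad R E).idealSpan S)

/-- The class of a tree in a presented operad. -/
def presentedOf {R : Type u} [CommRing R] {E : ℕ → Type}
    (S : ∀ (I : Type) [Finite I], (freeOperad R E).Obj I → Prop) {I : Type} [Finite I]
    (t : OpTree E I) (ht : t.Linear) : (presented R E S).Obj I :=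
  SymOperad.quotMk _ (freeOf R t ht)

namespace OpTree

variable {E : ℕ → Type} {X : Type}

theorem linear_corolla {k : ℕ} (g : E k) : (node g leaf : OpTree E (Fin k)).Linear := by
  have h : (node g leaf : OpTree E (Fin k)).leaves = List.finRange k := by
    have h1 : (List.ofFn fun i : Fin k => (leaf i : OpTree E (Fin k)).leaves) =
        (List.finRange k).map fun i => [i] := by
      rw [List.ofFn_eq_map]
      rfl
    rw [leaves, h1, ← List.flatMap_def]
    simp
  rw [Linear, h]
  exact ⟨List.nodup_finRange k, List.mem_finRange⟩

@[simp] theorem leaves_leaf (x : X) : (leaf x : OpTree E X).leaves = [x] := rfl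

@[simp] theorem leaves_node_two (g : E 2) (a b : OpTree E X) :
    (node g ![a, b]).leaves = a.leaves ++ b.leaves := by
  simp [leaves]

end OpTree

/-- The class of a generator in a presented operad. -/
def presentedGen {R : Type u} [CommRing R] {E : ℕ → Type}
    (S : ∀ (I : Type) [Finite I], (freeOperad R E).Obj I → Prop) {k : ℕ} (g : E k) :
    (presented R E S).Obj (Fin k) :=
  presentedOf S (OpTree.node g OpTree.leaf) (OpTree.linear_corolla g)

/-! ## Operads generated by binary operations -/

/-- A single binary generator. -/
inductive OneBinary : ℕ → Type
  | mul : OneBinary 2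

/-- The tree of the product of two trees, for one binary generator. -/
def OneBinary.prod {X : Type} (a b : OpTree OneBinary X) : OpTree OneBinary X :=
  OpTree.node OneBinary.mul ![a, b]

section Relations

open OpTree OneBinary

theorem OneBinary.leaves_prod {X : Type} (a b : OpTree OneBinary X) :
    (prod a b).leaves = a.leaves ++ b.leaves := leaves_node_two _ _ _

/-- `(i j) k`, for a permutation `(i, j, k)` of the inputs -/
def OneBinary.left (R : Type u) [CommRing R] (i j k : Fin 3)
    (h : ([i, j, k] : List (Fin 3)).Nodup ∧ ∀ x, x ∈ [i, j, k]) :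
    (freeOperad R OneBinary).Obj (Fin 3) :=
  freeOf R (prod (prod (leaf i) (leaf j)) (leaf k)) h

/-- `i (j k)`, for a permutation `(i, j, k)` of the inputs -/
def OneBinary.right (R : Type u) [CommRing R] (i j k : Fin 3)
    (h : ([i, j, k] : List (Fin 3)).Nodup ∧ ∀ x, x ∈ [i, j, k]) :
    (freeOperad R OneBinary).Obj (Fin 3) :=
  freeOf R (prod (leaf i) (prod (leaf j) (leaf k))) h

/-- `(x ∘ y) ∘ z - x ∘ (y ∘ z) = (x ∘ z) ∘ y - x ∘ (z ∘ y)` -/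
inductive PreLieRel (R : Type u) [CommRing R] :
    ∀ (I : Type) [Finite I], (freeOperad R OneBinary).Obj I → Prop
  | preLie : PreLieRel R (Fin 3)
      ((left R 0 1 2 (by decide) - right R 0 1 2 (by decide)) -
        (left R 0 2 1 (by decide) - right R 0 2 1 (by decide)))

/-- `(x · y) · z = x · (y · z) + x · (z · y)` -/
inductive ZinRel (R : Type u) [CommRing R] :
    ∀ (I : Type) [Finite I], (freeOperad R OneBinary).Obj I → Prop
  | zin : ZinRel R (Fin 3)
      (left R 0 1 2 (by decide) - (right R 0 1 2 (by decide) + right R 0 2 1 (by decide)))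

end Relations

/-- The operad of pre-Lie algebras. -/
abbrev PreLieOperad (R : Type u) [CommRing R] : SymOperad.{u, u} R :=
  presented R OneBinary (PreLieRel R)

/-- The pre-Lie product `x₀ ∘ x₁`. -/
def PreLieOperad.circ (R : Type u) [CommRing R] : (PreLieOperad R).Obj (Fin 2) :=
  presentedGen (PreLieRel R) OneBinary.mul

/-- The operad of Zinbiel (dual Leibniz) algebras. -/
abbrev ZinOperad (R : Type u) [CommRing R] : SymOperad.{u, u} R :=
  presented R OneBinary (ZinRel R)

/-- The Zinbiel product `x₀ · x₁`. -/
def ZinOperad.mul (R : Type u) [CommRing R] : (ZinOperad R).Obj (Fin 2) :=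
  presentedGen (ZinRel R) OneBinary.mul

/-- The generators of the dendriform operad. -/
inductive DendGen : ℕ → Type
  | prec : DendGen 2
  | succ : DendGen 2

namespace DendGen

open OpTree

variable {X : Type}

/-- The tree `a ≺ b`. -/
def lt (a b : OpTree DendGen X) : OpTree DendGen X := node prec ![a, b]

/-- The tree `a ≻ b`. -/
def gt (a b : OpTree DendGen X) : OpTree DendGen X := node succ ![a, b]

@[simp] theorem leaves_lt (a b : OpTree DendGen X) : (lt a b).leaves = a.leaves ++ b.leaves :=
  leaves_node_two _ _ _

@[simp] theorem leaves_gt (a b : OpTree DendGen X) : (gt a b).leaves = a.leaves ++ b.leaves :=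
  leaves_node_two _ _ _

theorem linear_of_leaves {t : OpTree DendGen (Fin 3)} (h : t.leaves = [0, 1, 2]) : t.Linear := by
  rw [Linear, h]
  decide

end DendGen

open OpTree DendGen in
/-- The three dendriform relations, in the variables `x = 0`, `y = 1`, `z = 2`:
`(x ≺ y) ≺ z = x ≺ (y ≺ z) + x ≺ (y ≻ z)`, `(x ≻ y) ≺ z = x ≻ (y ≺ z)` and
`x ≻ (y ≻ z) = (x ≻ y) ≻ z + (x ≺ y) ≻ z`. -/
inductive DendRel (R : Type u) [CommRing R] :
    ∀ (I : Type) [Finite I], (freeOperad R DendGen).Obj I → Prop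
  | prec_prec : DendRel R (Fin 3)
      (freeOf R (lt (lt (leaf 0) (leaf 1)) (leaf 2)) (linear_of_leaves (by simp)) -
        (freeOf R (lt (leaf 0) (lt (leaf 1) (leaf 2))) (linear_of_leaves (by simp)) +
          freeOf R (lt (leaf 0) (gt (leaf 1) (leaf 2))) (linear_of_leaves (by simp))))
  | succ_prec : DendRel R (Fin 3)
      (freeOf R (lt (gt (leaf 0) (leaf 1)) (leaf 2)) (linear_of_leaves (by simp)) -
        freeOf R (gt (leaf 0) (lt (leaf 1) (leaf 2))) (linear_of_leaves (by simp)))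
  | succ_succ : DendRel R (Fin 3)
      (freeOf R (gt (leaf 0) (gt (leaf 1) (leaf 2))) (linear_of_leaves (by simp)) -
        (freeOf R (gt (gt (leaf 0) (leaf 1)) (leaf 2)) (linear_of_leaves (by simp)) +
          freeOf R (gt (lt (leaf 0) (leaf 1)) (leaf 2)) (linear_of_leaves (by simp))))

/-- The operad of dendriform algebras. -/
abbrev DendOperad (R : Type u) [CommRing R] : SymOperad.{u, u} R :=
  presented R DendGen (DendRel R)

/-- The operation `x₀ ≺ x₁`. -/
def DendOperad.prec (R : Type u) [CommRing R] : (DendOperad R).Obj (Fin 2) :=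
  presentedGen (DendRel R) DendGen.prec

/-- The operation `x₀ ≻ x₁`. -/
def DendOperad.succ (R : Type u) [CommRing R] : (DendOperad R).Obj (Fin 2) :=
  presentedGen (DendRel R) DendGen.succ

/-! ## The brace operad -/

/-- One generator `{x₀ ∣ x₁, …, x_{n+1}}` in `n + 2` variables for every `n ≥ 0`. -/
inductive BraceGen : ℕ → Type
  | corolla (n : ℕ) : BraceGen (n + 2)

namespace BraceGen

open OpTree

variable {X : Type}

/-- The tree `{z ∣ l₁, …, l_k}`, with the convention `{z ∣ } = z` when the list is empty. -/
def brace (z : OpTree BraceGen X) : List (OpTree BraceGen X) → OpTree BraceGen X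
  | [] => z
  | a :: l => node (corolla l.length) (z :: a :: l).get

/-- The labels of the relation with parameters `n` and `m`: one letter `z`, the letters
`x₁, …, x_n` and the letters `y₁, …, y_m`. -/
abbrev Label (n m : ℕ) : Type := Unit ⊕ (Fin n ⊕ Fin m)

/-- The letter `z` -/
def varZ (n m : ℕ) : OpTree BraceGen (Label n m) := leaf (Sum.inl ())

/-- The letters `x_i` -/
def varX (n m : ℕ) (i : Fin n) : OpTree BraceGen (Label n m) := leaf (Sum.inr (Sum.inl i))

/-- The letters `y_j` -/
def varY (n m : ℕ) (j : Fin m) : OpTree BraceGen (Label n m) := leaf (Sum.inr (Sum.inr j))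

/-- `{{z ∣ x₁, …, x_n} ∣ y₁, …, y_m}` -/
def lhs (n m : ℕ) : OpTree BraceGen (Label n m) :=
  brace (brace (varZ n m) (List.ofFn (varX n m))) (List.ofFn (varY n m))

/-- For a map `f` from the letters `y` to `{0, …, 2n}`, the list `Y_k` of the letters that are
sent to `k`. When `f` is monotone, `Y_0, …, Y_{2n}` are successive, possibly empty, intervals, and
every decomposition into `2n + 1` successive intervals arises from exactly one monotone `f`. -/
def block (n m : ℕ) (f : Fin m → Fin (2 * n + 1)) (k : ℕ) : List (OpTree BraceGen (Label n m)) :=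
  ((List.finRange m).filter fun j => (f j : ℕ) = k).map (varY n m)

/-- `{z ∣ Y_0, {x₁ ∣ Y_1}, Y_2, {x₂ ∣ Y_3}, Y_4, …, Y_{2n-2}, {x_n ∣ Y_{2n-1}}, Y_{2n}}` -/
def rhs (n m : ℕ) (f : Fin m → Fin (2 * n + 1)) : OpTree BraceGen (Label n m) :=
  brace (varZ n m) (block n m f 0 ++ (List.finRange n).flatMap fun i =>
    brace (varX n m i) (block n m f (2 * i + 1)) :: block n m f (2 * i + 2))

@[simp] theorem leaves_brace (z : OpTree BraceGen X) (l : List (OpTree BraceGen X)) :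
    (brace z l).leaves = z.leaves ++ l.flatMap leaves := by
  cases l with
  | nil => simp [brace]
  | cons a l =>
    have h : (List.ofFn fun i : Fin (l.length + 2) => ((z :: a :: l).get i).leaves) =
        (z :: a :: l).map leaves := by
      refine Eq.trans (List.map_ofFn (f := (z :: a :: l).get) (g := leaves)).symm ?_
      exact congrArg _ (List.ofFn_get (z :: a :: l))
    rw [brace, leaves, h]
    simp [List.flatMap_def]

theorem flatMap_leaves_map {Y : Type} (l : List Y) (v : Y → X) :
    (l.map fun y => (leaf (v y) : OpTree BraceGen X)).flatMap leaves = l.map v := by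
  rw [List.flatMap_map, List.map_eq_flatMap]
  rfl

theorem linear_lhs (n m : ℕ) : (lhs n m).Linear := by
  have h : (lhs n m).leaves = Sum.inl () :: ((List.finRange n).map (fun i => Sum.inr (Sum.inl i)) ++
      (List.finRange m).map (fun j => Sum.inr (Sum.inr j))) := by
    simp only [lhs, varZ, leaves_brace, List.ofFn_eq_map]
    erw [flatMap_leaves_map, flatMap_leaves_map]
    simp
  rw [Linear, h]
  constructor
  · rw [List.nodup_cons, List.nodup_append]
    refine ⟨by simp, (List.nodup_finRange n).map fun a b hab => by simpa using hab,
      (List.nodup_finRange m).map fun a b hab => by simpa using hab, by simp⟩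
  · rintro (_ | x | y) <;> simp

theorem leaves_block (n m : ℕ) (f : Fin m → Fin (2 * n + 1)) (k : ℕ) :
    (block n m f k).flatMap leaves =
      ((List.finRange m).filter fun j => (f j : ℕ) = k).map (fun j => Sum.inr (Sum.inr j)) :=
  flatMap_leaves_map _ _

theorem linear_rhs (n m : ℕ) (f : Fin m → Fin (2 * n + 1)) : (rhs n m f).Linear := by
  have h : (rhs n m f).leaves = Sum.inl () :: ((block n m f 0).flatMap leaves ++
      (List.finRange n).flatMap fun i : Fin n => Sum.inr (Sum.inl i) ::
        ((block n m f (2 * i + 1)).flatMap leaves ++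
          (block n m f (2 * i + 2)).flatMap leaves)) := by
    simp [rhs, varZ, varX, List.flatMap_assoc]
  have hnd : ∀ k, ((block n m f k).flatMap leaves).Nodup := fun k => by
    rw [leaves_block]
    exact ((List.nodup_finRange m).filter _).map fun a b hab => by simpa using hab
  rw [Linear, h]
  constructor
  · rw [List.nodup_cons, List.nodup_append]
    refine ⟨?_, hnd _, List.nodup_flatMap.2 ⟨fun i _ => ?_, ?_⟩, ?_⟩
    · simp [leaves_block]
    · rw [List.nodup_cons, List.nodup_append]
      refine ⟨by simp [leaves_block], hnd _, hnd _, ?_⟩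
      intro a ha b hb
      simp only [leaves_block, List.mem_map, List.mem_filter, decide_eq_true_eq] at ha hb
      grind
    · refine (List.nodup_finRange n).imp fun {i i'} hi => ?_
      have hi' : (i : ℕ) ≠ i' := fun h => hi (Fin.ext h)
      intro a ha hb
      simp only [leaves_block, List.mem_cons, List.mem_append, List.mem_map, List.mem_filter,
        decide_eq_true_eq] at ha hb
      grind
    · intro a ha b hb
      simp only [leaves_block, List.mem_flatMap, List.mem_cons, List.mem_append, List.mem_map,
        List.mem_filter, decide_eq_true_eq] at ha hb
      grind
  · rintro (_ | x | y)
    · simp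
    · simp
    · simp only [leaves_block, List.mem_flatMap, List.mem_cons, List.mem_append, List.mem_map,
        List.mem_filter, decide_eq_true_eq]
      right
      have hf := (f y).isLt
      rcases Nat.eq_zero_or_pos (f y : ℕ) with h0 | h0
      · exact Or.inl ⟨y, ⟨List.mem_finRange y, h0⟩, rfl⟩
      · refine Or.inr ⟨⟨((f y : ℕ) - 1) / 2, by omega⟩, List.mem_finRange _, Or.inr ?_⟩
        rcases Nat.even_or_odd' (f y : ℕ) with ⟨c, hc | hc⟩
        · exact Or.inr ⟨y, ⟨List.mem_finRange y, by simp only; omega⟩, rfl⟩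
        · exact Or.inl ⟨y, ⟨List.mem_finRange y, by simp only; omega⟩, rfl⟩

end BraceGen

open BraceGen in
/-- The brace relations, for `n, m ≥ 1`: `{{z ∣ x₁, …, x_n} ∣ y₁, …, y_m}` is the sum of
`{z ∣ Y_0, {x₁ ∣ Y_1}, Y_2, …, {x_n ∣ Y_{2n-1}}, Y_{2n}}` over the decompositions of the ordered set
`{y₁, …, y_m}` into successive, possibly empty, intervals `Y_0, …, Y_{2n}`. -/
inductive BraceRel (R : Type u) [CommRing R] :
    ∀ (I : Type) [Finite I], (freeOperad R BraceGen).Obj I → Prop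
  | brace_brace (n m : ℕ) (hn : 1 ≤ n) (hm : 1 ≤ m) : BraceRel R (Label n m)
      (freeOf R (lhs n m) (linear_lhs n m) -
        ∑ f : {f : Fin m → Fin (2 * n + 1) // Monotone f}, freeOf R (rhs n m f) (linear_rhs n m f))

/-- The operad of brace algebras. -/
abbrev BraceOperad (R : Type u) [CommRing R] : SymOperad.{u, u} R :=
  presented R BraceGen (BraceRel R)

/-- The operation `{x₀ ∣ x₁, …, x_{n+1}}`. -/
def BraceOperad.corolla (R : Type u) [CommRing R] (n : ℕ) : (BraceOperad R).Obj (Fin (n + 2)) :=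
  presentedGen (BraceRel R) (BraceGen.corolla n)

/-! ## The morphism from `Brace` to `Dend` on corollas -/

namespace DendGen

open OpTree

variable {X : Type}

/-- `x₁ ≺ (x₂ ≺ (⋯ ≺ x_k))`, for the nonempty list `x₁, …, x_k` -/
def nearrow : OpTree DendGen X → List (OpTree DendGen X) → OpTree DendGen X
  | x, [] => x
  | x, y :: l => lt x (nearrow y l)

/-- `((x₁ ≻ x₂) ≻ ⋯ ) ≻ x_k`, for the nonempty list `x₁, …, x_k` -/
def searrow (x : OpTree DendGen X) (l : List (OpTree DendGen X)) : OpTree DendGen X :=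
  l.foldl gt x

/-- `t ≺ searrow l`, or `t` if the list `l` is empty -/
def ltSearrow (t : OpTree DendGen X) : List (OpTree DendGen X) → OpTree DendGen X
  | [] => t
  | x :: l => lt t (searrow x l)

/-- `nearrow l ≻ t`, or `t` if the list `l` is empty -/
def nearrowGt (t : OpTree DendGen X) : List (OpTree DendGen X) → OpTree DendGen X
  | [] => t
  | x :: l => gt (nearrow x l) t

/-- In the variables `x₀, …, x_n`, the tree `nearrow (x₁, …, x_a) ≻ x₀ ≺ searrow (x_{a+1}, …, x_n)`,
where an operation with an empty list of arguments is omitted. -/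
def psiTree (n a : ℕ) : OpTree DendGen (Fin (n + 1)) :=
  nearrowGt (ltSearrow (leaf 0) ((List.ofFn fun j : Fin n => leaf j.succ).drop a))
    ((List.ofFn fun j : Fin n => leaf j.succ).take a)

theorem leaves_nearrow (x : OpTree DendGen X) (l : List (OpTree DendGen X)) :
    (nearrow x l).leaves = x.leaves ++ l.flatMap leaves := by
  induction l generalizing x with
  | nil => simp [nearrow]
  | cons y l ih => simp [nearrow, ih]

theorem leaves_searrow (x : OpTree DendGen X) (l : List (OpTree DendGen X)) :
    (searrow x l).leaves = x.leaves ++ l.flatMap leaves := by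
  induction l generalizing x with
  | nil => simp [searrow]
  | cons y l ih =>
    have h := ih (gt x y)
    simp only [searrow, List.foldl_cons] at h ⊢
    simp [h]

theorem leaves_ltSearrow (t : OpTree DendGen X) (l : List (OpTree DendGen X)) :
    (ltSearrow t l).leaves = t.leaves ++ l.flatMap leaves := by
  cases l <;> simp [ltSearrow, leaves_searrow]

theorem leaves_nearrowGt (t : OpTree DendGen X) (l : List (OpTree DendGen X)) :
    (nearrowGt t l).leaves = l.flatMap leaves ++ t.leaves := by
  cases l <;> simp [nearrowGt, leaves_nearrow]

theorem linear_psiTree (n a : ℕ) : (psiTree n a).Linear := by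
  have h : (psiTree n a).leaves.Perm (List.finRange (n + 1)) := by
    rw [psiTree, leaves_nearrowGt, leaves_ltSearrow, leaves_leaf, List.singleton_append]
    refine List.perm_middle.trans ?_
    rw [← List.flatMap_append, List.take_append_drop, List.finRange_succ]
    refine List.Perm.cons _ (List.Perm.of_eq ?_)
    rw [List.ofFn_eq_map, List.flatMap_map, List.map_eq_flatMap]
    rfl
  exact ⟨h.nodup_iff.2 (List.nodup_finRange _), fun x => h.mem_iff.2 (List.mem_finRange x)⟩

end DendGen

/-- In the variables `x₀, …, x_n`, the alternating sum over `0 ≤ a ≤ n` of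
`(-1)^a nearrow (x₁, …, x_a) ≻ x₀ ≺ searrow (x_{a+1}, …, x_n)` in the operad `Dend`. -/
def DendOperad.psiCorolla (R : Type u) [CommRing R] (n : ℕ) : (DendOperad R).Obj (Fin (n + 1)) :=
  ∑ a ∈ Finset.range (n + 1),
    (-1 : R) ^ a • presentedOf (DendRel R) (DendGen.psiTree n a) (DendGen.linear_psiTree n a)

/-- The ideal of `Q` generated by the image of `P_+ = (P(k))_{k ≥ 2}` under a morphism. -/
def SymOperad.Hom.plusIdeal {R : Type u} [CommRing R] {P : SymOperad.{u, v} R}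
    {Q : SymOperad.{u, w} R} (α : SymOperad.Hom P Q) : SymOperad.OpIdeal Q :=
  Q.idealSpan fun I _ q => 2 ≤ Nat.card I ∧ ∃ p : P.Obj I, α.app I p = q

end

/-! Operadic identities are reduced to identities in algebras. For an operad Q and a finite set I,
the product of the modules Q(S) over all subsets S of I is a Q-algebra (`TwistedAlg`), where
operations act by summing over decompositions of S. Applied to the identity operations placed at the
points of I, an operation returns itself in the component S = I, so it is determined by its action
(`eq_of_op_gen_eq`). Inputs are labelled, so nothing is symmetrised or divided and R is arbitrary. A
morphism from Dend to Q makes this a dendriform algebra. The identity of Dend and the projections to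
quotients of Dend are the cases that matter.

In a dendriform algebra A the axioms say that A is a bimodule over the unital algebra on R × A with
product x ≺ y + x ≻ y. The elements `word` (the iterated ≻) and `coword` (the signed iterated ≺) are
inverse to each other for convolution along deconcatenation of lists. The alternating sum that
defines ψ is a conjugation: {z ∣ l} is the sum of coword(a) · z · word(b) over l = ab (`brace`).
Summed over the words V₀, {x₁ ∣ V₁}, V₂, …, coword becomes coword(v) * coword(w) and word becomes
word(w) * word(v) (`sumShuffle_coword`, `sumShuffle_word`). Deconcatenation respects these words
(`sumShuffle_sumSplit`), so bracketing by w and then by v is conjugation by the products. This is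
the brace relation, hence ψ exists. That α exists is a direct computation.

The ideal generated by the image of a presented operad in arities at least two is generated by the
images of the generators (`Hom.plusIdeal_le`). For α this is the one element x ≺ y - y ≻ x, which is
also the image of the first brace (`psiCorolla_one`). Conversely, modulo this element ≻ is the
opposite of ≺, so the left and right actions agree and the product is commutative. Then {z ∣ l}
becomes z · (sum of coword(a) * word(b)), which is zero for nonempty l (`DendAlg.brace_eq_zero`).
Thus the two ideals coincide. In the quotient the first dendriform relation turns into the Zinbiel
relation, and conversely x · y and y · x satisfy the dendriform relations in Zin. The two resulting
morphisms are inverse because they are so on generators. -/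

noncomputable section

/-! ## Positions of leaves and evaluation of trees -/

namespace OpTree

variable {E : ℕ → Type} {X Y : Type}

/-- The positions of the leaves of a tree. -/
def Pos : OpTree E X → Type
  | leaf _ => Unit
  | node _ c => Σ i, (c i).Pos

instance (t : OpTree E X) : Finite t.Pos := by
  induction t with
  | leaf x => exact inferInstanceAs (Finite Unit)
  | node g c ih => exact inferInstanceAs (Finite (Σ i, (c i).Pos))

/-- The label of the leaf at a position. -/
def lab : (t : OpTree E X) → t.Pos → X
  | leaf x, _ => x
  | node _ c, p => (c p.1).lab p.2

theorem mem_leaves_iff (t : OpTree E X) (x : X) : x ∈ t.leaves ↔ ∃ p, t.lab p = x := by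
  induction t with
  | leaf y => simpa [leaves, lab, eq_comm] using fun _ => ⟨()⟩
  | node g c ih =>
    simp only [leaves, List.mem_flatten, List.mem_ofFn, exists_exists_eq_and, ih]
    exact ⟨fun ⟨i, p, h⟩ => ⟨⟨i, p⟩, h⟩, fun ⟨⟨i, p⟩, h⟩ => ⟨i, p, h⟩⟩

theorem lab_injective {t : OpTree E X} (h : t.leaves.Nodup) : Function.Injective t.lab := by
  induction t with
  | leaf y => exact fun _ _ _ => rfl
  | node g c ih =>
    rw [leaves, List.nodup_flatten] at h
    have h1 : ∀ i, (c i).leaves.Nodup := fun i => h.1 _ (List.mem_ofFn.2 ⟨i, rfl⟩)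
    have h2 := List.pairwise_ofFn.1 h.2
    rintro ⟨i, p⟩ ⟨j, q⟩ (hpq : (c i).lab p = (c j).lab q)
    rcases lt_trichotomy i j with hij | rfl | hij
    · exact (h2 hij ((mem_leaves_iff _ _).2 ⟨p, rfl⟩) ((mem_leaves_iff _ _).2 ⟨q, hpq.symm⟩)).elim
    · rw [ih i (h1 i) hpq]
    · exact (h2 hij ((mem_leaves_iff _ _).2 ⟨q, rfl⟩) ((mem_leaves_iff _ _).2 ⟨p, hpq⟩)).elim

/-- The labels of a linear tree are in bijection with the positions of its leaves. -/
def Linear.posEquiv {t : OpTree E X} (h : t.Linear) : t.Pos ≃ X :=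
  Equiv.ofBijective t.lab ⟨lab_injective h.1, fun x => (mem_leaves_iff t x).1 (h.2 x)⟩

/-- The positions of the leaves after substitution. -/
def posBind : (t : OpTree E X) → (f : X → OpTree E Y) →
    (Σ p : t.Pos, (f (t.lab p)).Pos) ≃ (t.bind f).Pos
  | leaf x, f => unitSigma (f x).Pos
  | node _ c, f => (Equiv.sigmaAssoc fun i p => (f ((c i).lab p)).Pos).trans
      (Equiv.sigmaCongrRight fun i => posBind (c i) f)

theorem lab_posBind (t : OpTree E X) (f : X → OpTree E Y) (x : Σ p : t.Pos, (f (t.lab p)).Pos) :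
    (t.bind f).lab (posBind t f x) = (f (t.lab x.1)).lab x.2 := by
  induction t with
  | leaf y => rfl
  | node g c ih => exact ih x.1.1 ⟨x.1.2, x.2⟩

end OpTree

/-! ### Evaluation of trees in an operad, and the free operad -/

namespace SymOperad

variable {R : Type u} [CommRing R] {E : ℕ → Type} {X Y : Type} {Q : SymOperad.{u, v} R}

theorem map_symm_map (Q : SymOperad.{u, v} R) {I J : Type} [Finite I] [Finite J] (e : I ≃ J)
    (p : Q.Obj I) : Q.map e.symm (Q.map e p) = p := by
  rw [← Q.map_trans, Equiv.self_trans_symm, Q.map_refl]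

/-- The operation defined by a tree, given values of the generators. -/
def eval (γ : ∀ k, E k → Q.Obj (Fin k)) : (t : OpTree E X) → Q.Obj t.Pos
  | .leaf _ => Q.one
  | .node (k := k) g c => Q.comp (γ k g) fun i => eval γ (c i)

/-- Substitution is composition: the unit axiom of Q settles a leaf, and associativity settles a
node. Working with positions instead of labels lets the induction run over trees whose labels may
repeat. -/
theorem eval_bind (γ : ∀ k, E k → Q.Obj (Fin k)) (t : OpTree E X) (f : X → OpTree E Y) :
    eval γ (t.bind f) =
      Q.map (t.posBind f) (Q.comp (eval γ t) fun p => eval γ (f (t.lab p))) := by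
  induction t with
  | leaf x => exact (Q.one_comp _).symm
  | node g c ih =>
    refine Eq.trans (congrArg (Q.comp (γ _ g)) (funext ih)) ?_
    refine (Q.comp_map_right _ _ _).trans ?_
    rw [← Q.comp_assoc, ← Q.map_trans]
    rfl

/-- The positions of the leaves after relabelling. -/
def _root_.OpTree.posRelabel (t : OpTree E X) (f : X → Y) :
    t.Pos ≃ (t.bind fun x => OpTree.leaf (f x)).Pos :=
  (Equiv.sigmaPUnit t.Pos).symm.trans (t.posBind fun x => OpTree.leaf (f x))

theorem _root_.OpTree.lab_posRelabel (t : OpTree E X) (f : X → Y) (p : t.Pos) :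
    (t.bind fun x => OpTree.leaf (f x)).lab (t.posRelabel f p) = f (t.lab p) :=
  t.lab_posBind (fun x => OpTree.leaf (f x)) ⟨p, ()⟩

theorem eval_relabel (γ : ∀ k, E k → Q.Obj (Fin k)) (t : OpTree E X) (f : X → Y) :
    eval γ (t.bind fun x => OpTree.leaf (f x)) = Q.map (t.posRelabel f) (eval γ t) := by
  refine (eval_bind γ t _).trans ?_
  refine Eq.trans (congrArg (Q.map (t.posBind fun x => OpTree.leaf (f x))) ?_)
    (Q.map_trans (Equiv.sigmaPUnit t.Pos).symm (t.posBind fun x => OpTree.leaf (f x))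
      (eval γ t)).symm
  refine (Q.map_symm_map (Equiv.sigmaPUnit t.Pos) _).symm.trans ?_
  exact congrArg (Q.map (Equiv.sigmaPUnit t.Pos).symm) (Q.comp_one (eval γ t))

/-- The operation defined by a linear tree, with inputs the labels of the leaves. -/
def evalLin (γ : ∀ k, E k → Q.Obj (Fin k)) {I : Type} [Finite I] (t : OpTree E I)
    (ht : t.Linear) : Q.Obj I :=
  Q.map ht.posEquiv (eval γ t)

theorem evalLin_map (γ : ∀ k, E k → Q.Obj (Fin k)) {I J : Type} [Finite I] [Finite J]
    (e : I ≃ J) (t : OpTree E I) (ht : t.Linear) :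
    evalLin γ _ (ht.map e) = Q.map e (evalLin γ t ht) := by
  rw [evalLin, evalLin, eval_relabel, ← Q.map_trans, ← Q.map_trans]
  congr 2
  ext p
  exact t.lab_posRelabel e p

/-- This is what makes evaluation of trees compatible with operadic composition. All relabellings
are pushed outside, and the two resulting bijections agree because both send a position to its
label. -/
theorem evalLin_graft (γ : ∀ k, E k → Q.Obj (Fin k)) {K : Type} [Finite K] {J : K → Type}
    [∀ k, Finite (J k)] (t : OpTree E K) (ht : t.Linear) (s : ∀ k, OpTree E (J k))
    (hs : ∀ k, (s k).Linear) :
    evalLin γ _ (ht.graft hs) = Q.comp (evalLin γ t ht) fun k => evalLin γ (s k) (hs k) := by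
  simp only [evalLin, Q.comp_map_left, Q.comp_map_right, ← Q.map_trans]
  rw [eval_bind]
  simp only [eval_relabel, Q.comp_map_right, ← Q.map_trans]
  congr 2
  refine Equiv.ext fun x => ?_
  refine (t.lab_posBind (fun x => (s x).bind fun j => OpTree.leaf (Sigma.mk x j)) _).trans ?_
  exact (s (t.lab x.1)).lab_posRelabel _ x.2

theorem evalLin_one (γ : ∀ k, E k → Q.Obj (Fin k)) :
    evalLin γ _ (LinTree.one (E := E)).2 = Q.one :=
  Q.map_refl _

theorem evalLin_corolla (γ : ∀ k, E k → Q.Obj (Fin k)) {k : ℕ} (g : E k) :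
    evalLin γ _ (OpTree.linear_corolla g) = γ k g := by
  refine Eq.trans ?_ (Q.comp_one (γ k g))
  refine congrArg (fun e => Q.map e _) ?_
  ext x
  rfl

/-- The linear extension of the evaluation of linear trees. -/
def freeApp (γ : ∀ k, E k → Q.Obj (Fin k)) (I : Type) [Finite I] :
    (LinTree E I →₀ R) →ₗ[R] Q.Obj I :=
  Finsupp.linearCombination R fun t : LinTree E I => evalLin γ t.1 t.2

theorem freeApp_single (γ : ∀ k, E k → Q.Obj (Fin k)) {I : Type} [Finite I] (t : LinTree E I)
    (a : R) : freeApp γ I (Finsupp.single t a) = a • evalLin γ t.1 t.2 :=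
  Finsupp.linearCombination_single R a t

theorem freeApp_map (γ : ∀ k, E k → Q.Obj (Fin k)) {I J : Type} [Finite I] [Finite J]
    (e : I ≃ J) (p : LinTree E I →₀ R) :
    freeApp γ J (Finsupp.lmapDomain R R (LinTree.map e) p) = Q.map e (freeApp γ I p) := by
  induction p using Finsupp.induction_linear with
  | zero => simp
  | add a b ha hb => simp only [map_add, ha, hb]
  | single t a =>
    rw [Finsupp.lmapDomain_apply, Finsupp.mapDomain_single, freeApp_single, freeApp_single,
      map_smul]
    exact congrArg (a • ·) (evalLin_map γ e t.1 t.2)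

theorem freeApp_comp (γ : ∀ k, E k → Q.Obj (Fin k)) {K : Type} [Finite K] {J : K → Type}
    [∀ k, Finite (J k)] (p : LinTree E K →₀ R) (q : ∀ k, LinTree E (J k) →₀ R) :
    freeApp γ (Σ k, J k) (freeComp R E p q) =
      Q.comp (freeApp γ K p) fun k => freeApp γ (J k) (q k) := by
  induction p using Finsupp.induction_linear with
  | zero => simp
  | add a b ha hb => simp only [map_add, add_apply, ha, hb]
  | single t a =>
    -- Both sides are multilinear in `q`, so comparing them on families of single trees is enough.
    have h : (freeApp γ (Σ k, J k)).compMultilinearMap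
          (freeComp R E (J := J) (Finsupp.single t a)) =
        (Q.comp (a • evalLin γ t.1 t.2)).compLinearMap (fun k => freeApp γ (J k)) := by
      refine Module.Basis.ext_multilinear (fun k => Finsupp.basisSingleOne) fun s => ?_
      simp only [Finsupp.coe_basisSingleOne, MultilinearMap.compLinearMap_apply,
        LinearMap.compMultilinearMap_apply, freeComp_single, finsuppProd_single,
        Finsupp.mapDomain_single, Finsupp.smul_single, smul_eq_mul, mul_one,
        freeApp_single, one_smul, map_smul, smul_apply]
      exact congrArg (a • ·) (evalLin_graft γ t.1 t.2 _ fun k => (s k).2)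
    rw [freeApp_single]
    exact congrArg (fun g => g q) h

/-- The morphism from the free operad determined by the values of the generators. -/
def freeHom (γ : ∀ k, E k → Q.Obj (Fin k)) : Hom (freeOperad R E) Q where
  app I _ := freeApp γ I
  app_map e p := freeApp_map γ e p
  app_one := (freeApp_single γ LinTree.one 1).trans ((one_smul R _).trans (evalLin_one γ))
  app_comp p q := freeApp_comp γ p q

theorem freeHom_freeOf (γ : ∀ k, E k → Q.Obj (Fin k)) {I : Type} [Finite I] (t : OpTree E I)
    (ht : t.Linear) : (freeHom γ).app I (freeOf R t ht) = evalLin γ t ht :=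
  (freeApp_single γ ⟨t, ht⟩ 1).trans (one_smul _ _)

end SymOperad

/-! ## Universal properties -/

namespace OpTree

variable {E : ℕ → Type} {X : Type}

/-- The tree `t` with its leaves labelled by their positions. -/
def taut : (t : OpTree E X) → OpTree E t.Pos
  | leaf _ => leaf ()
  | node g c => node g fun i => (taut (c i)).bind fun p => leaf (Sigma.mk i p)

theorem taut_bind (t : OpTree E X) : (t.taut.bind fun p => leaf (t.lab p)) = t := by
  induction t with
  | leaf x => rfl
  | node g c ih =>
    simp only [taut, bind, bind_bind]
    exact congrArg (node g) (funext ih)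

theorem linear_taut (t : OpTree E X) : t.taut.Linear := by
  induction t with
  | leaf x => exact (LinTree.one (E := E)).2
  | node g c ih => exact (linear_corolla g).graft ih

end OpTree

namespace SymOperad

variable {R : Type u} [CommRing R] {E : ℕ → Type}

theorem freeOf_map {I J : Type} [Finite I] [Finite J] (e : I ≃ J) (t : OpTree E I)
    (ht : t.Linear) :
    freeOf R _ (ht.map e) = (freeOperad R E).map e (freeOf R t ht) :=
  (Finsupp.mapDomain_single (f := LinTree.map e) (a := (⟨t, ht⟩ : LinTree E I))
    (b := (1 : R))).symm

theorem freeOf_graft {K : Type} [Finite K] {J : K → Type} [∀ k, Finite (J k)] (t : OpTree E K)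
    (ht : t.Linear) (s : ∀ k, OpTree E (J k)) (hs : ∀ k, (s k).Linear) :
    freeOf R _ (ht.graft hs) =
      (freeOperad R E).comp (freeOf R t ht) fun k => freeOf R (s k) (hs k) := by
  refine Eq.symm ((freeComp_single R E (⟨t, ht⟩ : LinTree E K) 1 _).trans ?_)
  rw [one_smul]
  refine (congrArg _ (finsuppProd_single R fun k => (⟨s k, hs k⟩ : LinTree E (J k)))).trans ?_
  exact Finsupp.mapDomain_single

/-! ### Morphisms out of free operads; kernels -/

namespace Hom

variable {P : SymOperad.{u, v} R} {Q : SymOperad.{u, w} R}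

/-- Labelled by its positions, a tree is literally the grafting of its subtrees on a corolla. A
morphism is therefore computed by induction; arbitrary labels are recovered afterwards by
relabelling. -/
theorem app_freeOf_taut (f : Hom (freeOperad R E) Q) {X : Type} (t : OpTree E X) :
    f.app t.Pos (freeOf R t.taut t.linear_taut) =
      eval (fun _ g => f.app _ (freeOf R (.node g .leaf) (OpTree.linear_corolla g))) t := by
  induction t with
  | leaf x => exact f.app_one
  | node g c ih =>
    refine (congrArg (f.app _) (freeOf_graft _ (OpTree.linear_corolla g) _
      fun i => (c i).linear_taut)).trans ?_
    refine (f.app_comp _ _).trans ?_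
    exact congrArg (Q.comp _) (funext ih)

theorem app_freeOf (f : Hom (freeOperad R E) Q) {I : Type} [Finite I] (t : OpTree E I)
    (ht : t.Linear) :
    f.app I (freeOf R t ht) =
      evalLin (fun _ g => f.app _ (freeOf R (.node g .leaf) (OpTree.linear_corolla g))) t ht := by
  rw [evalLin, ← app_freeOf_taut, ← f.app_map, ← freeOf_map]
  congr 2
  exact t.taut_bind.symm

/-- The identity morphism. -/
def id (P : SymOperad.{u, v} R) : Hom P P where
  app _ _ := LinearMap.id
  app_map _ _ := rfl
  app_one := rfl
  app_comp _ _ := rfl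

/-- The composite of two morphisms. -/
def trans {S : SymOperad R} (f : Hom P Q) (g : Hom Q S) : Hom P S where
  app I _ := g.app I ∘ₗ f.app I
  app_map e p := by simp only [LinearMap.comp_apply, f.app_map, g.app_map]
  app_one := by simp only [LinearMap.comp_apply, f.app_one, g.app_one]
  app_comp p q := by simp only [LinearMap.comp_apply, f.app_comp, g.app_comp]

/-- The kernel of a morphism. -/
def ker (f : Hom P Q) : OpIdeal P where
  carrier I _ := LinearMap.ker (f.app I)
  map_mem e p hp := by
    rw [LinearMap.mem_ker] at hp ⊢
    rw [f.app_map, hp, map_zero]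
  comp_mem_left p q hp := by
    rw [LinearMap.mem_ker] at hp ⊢
    rw [f.app_comp, hp, map_zero, zero_apply]
  comp_mem_right p q k hq := by
    rw [LinearMap.mem_ker] at hq ⊢
    rw [f.app_comp]
    exact MultilinearMap.map_coord_zero _ k hq

end Hom

/-! ### Generated ideals and quotient operads -/

section Ideals

variable {P : SymOperad.{u, v} R} {Q : SymOperad.{u, w} R}

theorem mem_idealSpan {S : ∀ (I : Type) [Finite I], P.Obj I → Prop} {I : Type} [Finite I]
    {p : P.Obj I} (hp : S I p) : p ∈ (P.idealSpan S).carrier I := by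
  simp only [idealSpan, Submodule.mem_iInf]
  exact fun T hT => hT I p hp

theorem idealSpan_le {S : ∀ (I : Type) [Finite I], P.Obj I → Prop} {T : OpIdeal P}
    (h : ∀ (I : Type) [Finite I] (p : P.Obj I), S I p → p ∈ T.carrier I) (I : Type) [Finite I] :
    (P.idealSpan S).carrier I ≤ T.carrier I :=
  iInf₂_le T h

/-- The projection to a quotient operad. -/
def quotHom (T : OpIdeal P) : Hom P (P.quot T) where
  app I _ := (T.carrier I).mkQ
  app_map _ _ := rfl
  app_one := rfl
  app_comp p q := (T.quotComp_mk p q).symm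

theorem quotHom_apply (T : OpIdeal P) {I : Type} [Finite I] (p : P.Obj I) :
    (quotHom T).app I p = quotMk T p := rfl

theorem quotMk_surjective (T : OpIdeal P) (I : Type) [Finite I] :
    Function.Surjective (quotMk T : P.Obj I → (P.quot T).Obj I) :=
  Submodule.Quotient.mk_surjective _

theorem quotMk_eq_zero (T : OpIdeal P) {I : Type} [Finite I] (p : P.Obj I) :
    quotMk T p = 0 ↔ p ∈ T.carrier I :=
  Submodule.Quotient.mk_eq_zero _

/-- The morphism from a quotient operad induced by a morphism that vanishes on the ideal. -/
def quotLift (T : OpIdeal P) (f : Hom P Q)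
    (h : ∀ (I : Type) [Finite I], T.carrier I ≤ f.ker.carrier I) : Hom (P.quot T) Q where
  app I _ := (T.carrier I).liftQ (f.app I) (h I)
  app_map e p := by
    obtain ⟨p, rfl⟩ := quotMk_surjective T _ p
    exact f.app_map e p
  app_one := f.app_one
  app_comp p q := by
    obtain ⟨p, rfl⟩ := quotMk_surjective T _ p
    obtain ⟨q, rfl⟩ : ∃ q' : ∀ k, P.Obj _, q = fun k => quotMk T (q' k) :=
      ⟨fun k => T.rep (q k), funext fun k => (T.mk_rep _).symm⟩
    exact (congrArg _ (T.quotComp_mk p q)).trans (f.app_comp p q)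

theorem quot_hom_ext {T : OpIdeal P} {f g : Hom (P.quot T) Q}
    (h : (quotHom T).trans f = (quotHom T).trans g) : f = g := by
  ext I _ x
  obtain ⟨x, rfl⟩ := quotMk_surjective T I x
  exact congrArg (fun k : Hom P Q => k.app I x) h

end Ideals

/-! ### Presented operads -/

section Presented

variable {S : ∀ (I : Type) [Finite I], (freeOperad R E).Obj I → Prop} {Q : SymOperad.{u, w} R}

theorem Hom.app_presentedOf (f : Hom (presented R E S) Q) {I : Type} [Finite I] (t : OpTree E I)
    (ht : t.Linear) :
    f.app I (presentedOf S t ht) = evalLin (fun k g => f.app (Fin k) (presentedGen S g)) t ht :=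
  ((quotHom _).trans f).app_freeOf t ht

theorem presented_induction {I : Type} [Finite I] {C : (presented R E S).Obj I → Prop}
    (zero : C 0) (add : ∀ p q, C p → C q → C (p + q)) (smul : ∀ (a : R) p, C p → C (a • p))
    (of : ∀ t ht, C (presentedOf S t ht)) (p : (presented R E S).Obj I) : C p := by
  obtain ⟨p, rfl⟩ := quotMk_surjective _ I p
  change LinTree E I →₀ R at p
  induction p using Finsupp.induction_linear with
  | zero => exact zero
  | add a b ha hb => exact add _ _ ha hb
  | single t a =>
    have h := smul a _ (of t.1 t.2)
    rwa [show (a • presentedOf S t.1 t.2 : (presented R E S).Obj I) =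
      quotMk _ (Finsupp.single t a : LinTree E I →₀ R) from ?_] at h
    exact congrArg (Submodule.Quotient.mk (p := ((freeOperad R E).idealSpan S).carrier I))
      ((Finsupp.smul_single a t (1 : R)).trans (by rw [smul_eq_mul, mul_one]))

theorem presented_hom_ext {f g : Hom (presented R E S) Q}
    (h : ∀ k (x : E k), f.app (Fin k) (presentedGen S x) = g.app (Fin k) (presentedGen S x)) :
    f = g := by
  ext I _ p
  induction p using presented_induction with
  | zero => simp only [map_zero]
  | add p q hp hq => simp only [map_add, hp, hq]
  | smul a p hp => simp only [map_smul, hp]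
  | of t ht => simp only [Hom.app_presentedOf, h]

/-- The morphism from a presented operad determined by values of the generators that satisfy the
relations. -/
def presentedLift (γ : ∀ k, E k → Q.Obj (Fin k))
    (h : ∀ (I : Type) [Finite I] (r : (freeOperad R E).Obj I), S I r → (freeHom γ).app I r = 0) :
    Hom (presented R E S) Q :=
  quotLift _ (freeHom γ) fun I _ => idealSpan_le h I

theorem presentedLift_gen (γ : ∀ k, E k → Q.Obj (Fin k))
    (h : ∀ (I : Type) [Finite I] (r : (freeOperad R E).Obj I), S I r → (freeHom γ).app I r = 0)
    {k : ℕ} (g : E k) : (presentedLift γ h).app (Fin k) (presentedGen S g) = γ k g :=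
  (freeHom_freeOf γ _ _).trans (evalLin_corolla γ g)

/-- The images of the generators under a morphism satisfy the relations. -/
theorem Hom.freeHom_presentedGen {I : Type} [Finite I]
    (f : Hom (presented R E S) Q)
    {r : (freeOperad R E).Obj I} (hr : S I r) :
    (freeHom fun k g => f.app (Fin k) (presentedGen S g)).app I r = 0 := by
  -- The morphism out of the free operad given by these values is `f` composed with the projection,
  -- and the projection kills the relations.
  have h : ∀ p : LinTree E I →₀ R, freeApp (fun k g => f.app (Fin k) (presentedGen S g)) I p =
      f.app I (quotMk ((freeOperad R E).idealSpan S) (p : (freeOperad R E).Obj I)) := by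
    intro p
    induction p using Finsupp.induction_linear with
    | zero => exact (map_zero (freeApp _ I)).trans (map_zero (f.app I)).symm
    | add a b ha hb =>
      exact (map_add _ _ _).trans ((congrArg₂ (· + ·) ha hb).trans (map_add (f.app I) _ _).symm)
    | single t a =>
      rw [freeApp_single, ← f.app_presentedOf, ← map_smul]
      refine congrArg (f.app I) ?_
      exact congrArg (Submodule.Quotient.mk (p := ((freeOperad R E).idealSpan S).carrier I))
        ((Finsupp.smul_single a t (1 : R)).trans (by rw [smul_eq_mul, mul_one]))
  refine (h r).trans ?_
  exact (congrArg _ ((quotMk_eq_zero _ _).2 (mem_idealSpan hr))).trans (map_zero (f.app I))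

/-- A tree with at least two leaves has a root generator, so its value is a composite whose
outermost operation lies in the ideal. The arity bound only excludes the single leaf, whose value is
the identity. -/
theorem evalLin_mem {T : OpIdeal Q} {γ : ∀ k, E k → Q.Obj (Fin k)}
    (h : ∀ k g, γ k g ∈ T.carrier (Fin k)) {I : Type} [Finite I] (hI : 2 ≤ Nat.card I)
    (t : OpTree E I) (ht : t.Linear) : evalLin γ t ht ∈ T.carrier I := by
  refine T.map_mem _ _ ?_
  cases t with
  | leaf x =>
    have h1 : Nat.card I = 1 := (Nat.card_congr ht.posEquiv).symm.trans (Nat.card_unique (α := Unit))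
    omega
  | node g c => exact T.comp_mem_left _ _ (h _ g)

/-- The ideal generated by the operations of arity at least two in the image of a presented operad
is contained in every ideal that contains the images of the generators. -/
theorem Hom.plusIdeal_le {f : Hom (presented R E S) Q} {T : OpIdeal Q}
    (h : ∀ k (g : E k), f.app (Fin k) (presentedGen S g) ∈ T.carrier (Fin k)) (I : Type)
    [Finite I] : f.plusIdeal.carrier I ≤ T.carrier I := by
  refine idealSpan_le (fun I _ q => ?_) I
  rintro ⟨hI, p, rfl⟩
  induction p using presented_induction with
  | zero => rw [map_zero]; exact zero_mem _
  | add p q hp hq => rw [map_add]; exact add_mem hp hq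
  | smul a p hp => rw [map_smul]; exact Submodule.smul_mem _ _ hp
  | of t ht => rw [Hom.app_presentedOf]; exact evalLin_mem h hI t ht

theorem Hom.mem_plusIdeal {P : SymOperad.{u, v} R} (f : Hom P Q) {I : Type} [Finite I]
    (hI : 2 ≤ Nat.card I) (p : P.Obj I) : f.app I p ∈ f.plusIdeal.carrier I :=
  mem_idealSpan ⟨hI, p, rfl⟩

end Presented

end SymOperad

/-! ## The twisted algebra over an operad -/

/-- Families of disjoint subsets, indexed by `K`, with union `S`. -/
def Parts (K : Type) {I : Type} (S : Set I) : Type :=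
  {T : K → Set I // (∀ x, x ∈ S ↔ ∃ k, x ∈ T k) ∧ ∀ x k l, x ∈ T k → x ∈ T l → k = l}

namespace Parts

variable {K K' I : Type} {S : Set I}

instance [Finite K] [Finite I] : Finite (Parts K S) := Subtype.finite

instance [Finite K] [Finite I] : Fintype (Parts K S) := Fintype.ofFinite _

/-- The bijection between the disjoint union of the parts and the whole set. -/
def equiv (T : Parts K S) : (Σ k, T.1 k) ≃ S :=
  Equiv.ofBijective (fun x => ⟨x.2.1, (T.2.1 _).2 ⟨x.1, x.2.2⟩⟩) (by
    constructor
    · rintro ⟨k, x, hx⟩ ⟨l, y, hy⟩ h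
      obtain rfl : x = y := congrArg Subtype.val h
      obtain rfl := T.2.2 x k l hx hy
      rfl
    · rintro ⟨x, hx⟩
      obtain ⟨k, hk⟩ := (T.2.1 x).1 hx
      exact ⟨⟨k, x, hk⟩, rfl⟩)

/-- Reindexing of the parts. -/
def reindex (e : K ≃ K') (T : Parts K' S) : Parts K S :=
  ⟨fun k => T.1 (e k), fun x => (T.2.1 x).trans (e.exists_congr_right (q := fun k => x ∈ T.1 k)).symm,
    fun x _ _ hk hl => e.injective (T.2.2 x _ _ hk hl)⟩

theorem reindex_bijective (e : K ≃ K') :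
    Function.Bijective (reindex e : Parts K' S → Parts K S) := by
  constructor
  · intro T T' h
    refine Subtype.ext (funext fun k => ?_)
    obtain ⟨k, rfl⟩ := e.surjective k
    exact congrFun (congrArg Subtype.val h) k
  · intro T
    refine ⟨reindex e.symm T, Subtype.ext (funext fun k => ?_)⟩
    exact congrArg T.1 (e.symm_apply_apply k)

/-- The partition into the parts of the parts. -/
def glue {L : K → Type} (x : Σ T : Parts K S, ∀ k, Parts (L k) (T.1 k)) :
    Parts (Σ k, L k) S :=
  ⟨fun y => (x.2 y.1).1 y.2, fun i => by
    rw [x.1.2.1]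
    simp only [(x.2 _).2.1]
    exact ⟨fun ⟨k, l, h⟩ => ⟨⟨k, l⟩, h⟩, fun ⟨⟨k, l⟩, h⟩ => ⟨k, l, h⟩⟩, by
    rintro i ⟨k, l⟩ ⟨k', l'⟩ h h'
    obtain rfl := x.1.2.2 i k k' (((x.2 _).2.1 i).2 ⟨_, h⟩) (((x.2 _).2.1 i).2 ⟨_, h'⟩)
    obtain rfl := (x.2 k).2.2 i l l' h h'
    rfl⟩

/-- Decomposing a set and then each of its parts is the same as decomposing it once, along the
disjoint union of the index sets. This is the combinatorial content of associativity in `op_comp`.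
-/
theorem glue_bijective {L : K → Type} :
    Function.Bijective (glue : (Σ T : Parts K S, ∀ k, Parts (L k) (T.1 k)) → _) := by
  constructor
  · rintro ⟨⟨U, hU⟩, V⟩ ⟨⟨U', hU'⟩, V'⟩ h
    have h1 : ∀ k l, (V k).1 l = (V' k).1 l := fun k l =>
      congrFun (congrArg Subtype.val h) (⟨k, l⟩ : Σ k, L k)
    obtain rfl : U = U' := by
      ext k x
      rw [(V k).2.1, (V' k).2.1]
      simp only [h1]
    obtain rfl : V = V' := funext fun k => Subtype.ext (funext (h1 k))
    rfl
  · intro T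
    refine ⟨⟨⟨fun k => {x | ∃ l, x ∈ T.1 ⟨k, l⟩}, fun x => ?_, ?_⟩, fun k =>
      ⟨fun l => T.1 ⟨k, l⟩, fun x => Iff.rfl, ?_⟩⟩, rfl⟩
    · rw [T.2.1]
      exact ⟨fun ⟨⟨k, l⟩, h⟩ => ⟨k, l, h⟩, fun ⟨k, l, h⟩ => ⟨⟨k, l⟩, h⟩⟩
    · rintro x k k' ⟨l, h⟩ ⟨l', h'⟩
      exact congrArg Sigma.fst (T.2.2 x _ _ h h')
    · intro x l l' h h'
      exact eq_of_heq (Sigma.mk.inj (T.2.2 x _ _ h h')).2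

end Parts

namespace SymOperad

variable {R : Type u} [CommRing R] (Q : SymOperad.{u, v} R) (I : Type) [Finite I]

/-- Families of operations of `Q`, one for every subset of `I`. This is an algebra over `Q`, in
which the products of families are sums over decompositions of subsets. -/
abbrev TwistedAlg : Type v := ∀ S : Set I, Q.Obj S

variable {Q I} {K K' : Type} [Finite K] [Finite K']

/-- The action of an operation on the twisted algebra. -/
def op (q : Q.Obj K) : MultilinearMap R (fun _ : K => TwistedAlg Q I) (TwistedAlg Q I) :=
  MultilinearMap.pi fun S => ∑ T : Parts K S, (Q.map T.equiv).compMultilinearMap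
    ((Q.comp q).compLinearMap fun k => LinearMap.proj (T.1 k))

theorem op_apply (q : Q.Obj K) (a : K → TwistedAlg Q I) (S : Set I) :
    op q a S = ∑ T : Parts K S, Q.map T.equiv (Q.comp q fun k => a k (T.1 k)) := by
  simp only [op, MultilinearMap.pi_apply, sum_apply]
  rfl

theorem op_add (p q : Q.Obj K) (a : K → TwistedAlg Q I) : op (p + q) a = op p a + op q a := by
  funext S
  simp only [op_apply, map_add, add_apply, Pi.add_apply, Finset.sum_add_distrib]

theorem op_smul (c : R) (p : Q.Obj K) (a : K → TwistedAlg Q I) : op (c • p) a = c • op p a := by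
  funext S
  simp only [op_apply, map_smul, smul_apply, Pi.smul_apply, Finset.smul_sum]

/-- The action on given elements, as a linear map. -/
def opLin (a : K → TwistedAlg Q I) : Q.Obj K →ₗ[R] TwistedAlg Q I where
  toFun q := op q a
  map_add' p q := op_add p q a
  map_smul' c p := op_smul c p a

theorem opLin_apply (a : K → TwistedAlg Q I) (q : Q.Obj K) : opLin a q = op q a := rfl

theorem op_map (e : K ≃ K') (q : Q.Obj K) (a : K' → TwistedAlg Q I) :
    op (Q.map e q) a = op q fun k => a (e k) := by
  funext S
  rw [op_apply, op_apply]
  refine Fintype.sum_bijective _ (Parts.reindex_bijective e) _ _ fun T => ?_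
  rw [Q.comp_map_left, ← Q.map_trans]
  refine congrArg (fun f => Q.map f _) ?_
  refine Equiv.ext fun x => ?_
  rfl

theorem op_one (a : Unit → TwistedAlg Q I) : op Q.one a = a () := by
  funext S
  rw [op_apply]
  let T₀ : Parts Unit S := ⟨fun _ => S, fun x => by simp, fun _ _ _ _ _ => rfl⟩
  have h : ∀ T : Parts Unit S, T = T₀ := fun T => by
    refine Subtype.ext (funext fun k => Set.ext fun x => ?_)
    exact ⟨fun hx => (T.2.1 x).2 ⟨k, hx⟩, fun hx => ((T.2.1 x).1 hx).choose_spec⟩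
  have : Unique (Parts Unit S) := ⟨⟨T₀⟩, h⟩
  rw [Fintype.sum_unique, h default]
  refine Eq.trans ?_ (Q.one_comp (a () S))
  refine congrArg (fun f => Q.map f _) ?_
  refine Equiv.ext fun x => ?_
  rfl

/-- Together with `op_map` and `op_one`, this says that the twisted algebra is an algebra over Q.
After reindexing by `Parts.glue`, the summands match by associativity in Q. -/
theorem op_comp {L : K → Type} [∀ k, Finite (L k)] (p : Q.Obj K) (q : ∀ k, Q.Obj (L k))
    (a : (Σ k, L k) → TwistedAlg Q I) :
    op (Q.comp p q) a = op p fun k => op (q k) fun l => a ⟨k, l⟩ := by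
  classical
  cases nonempty_fintype K
  funext S
  simp only [op_apply, MultilinearMap.map_sum, map_sum]
  rw [← Fintype.sum_sigma']
  symm
  refine Fintype.sum_bijective _ Parts.glue_bijective _ _ fun x => ?_
  rw [Q.comp_map_right, ← Q.comp_assoc, ← Q.map_trans, ← Q.map_trans]
  refine congrArg (fun f => Q.map f _) ?_
  refine Equiv.ext fun x => ?_
  rfl

/-- The element of the twisted algebra given by the identity operation placed at `i`. -/
def gen (i : I) : TwistedAlg Q I := fun S =>
  open Classical in
  if h : {i} = S then Q.map ((Equiv.ofUnique Unit ({i} : Set I)).trans (Equiv.setCongr h)) Q.one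
  else 0

theorem gen_self (i : I) :
    gen (Q := Q) i {i} = Q.map (Equiv.ofUnique Unit ({i} : Set I)) Q.one := by
  rw [gen, dif_pos rfl]
  rfl

theorem gen_of_ne (i : I) {S : Set I} (h : {i} ≠ S) : gen (Q := Q) i S = 0 := dif_neg h

/-- Faithfulness of the twisted algebra: among all decompositions of I only the one into the
singletons {i} contributes, and by the unit axiom its contribution is the operation itself. -/
theorem op_gen (q : Q.Obj I) : op q gen Set.univ = Q.map (Equiv.Set.univ I).symm q := by
  rw [op_apply]
  let T₀ : Parts I (Set.univ : Set I) := ⟨fun i => {i}, fun x => by simp, by simp⟩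
  rw [Fintype.sum_eq_single T₀]
  · simp only [T₀, gen_self]
    rw [Q.comp_map_right]
    conv_rhs => rw [← Q.comp_one q]
    rw [← Q.map_trans, ← Q.map_trans]
    refine congrArg (fun f => Q.map f _) ?_
    refine Equiv.ext fun x => ?_
    rfl
  · intro T hT
    -- In any other decomposition some part differs from the prescribed singleton, and there the
    -- generator vanishes.
    obtain ⟨i, hi⟩ : ∃ i, {i} ≠ T.1 i := by
      by_contra! h
      exact hT (Subtype.ext (funext fun i => (h i).symm))
    rw [MultilinearMap.map_coord_zero _ i (gen_of_ne i hi), map_zero]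

/-- An operation is determined by its action on the twisted algebra. -/
theorem eq_of_op_gen_eq {p q : Q.Obj I} (h : op p (gen (I := I)) = op q gen) : p = q := by
  have h1 := congrFun h Set.univ
  rw [op_gen, op_gen] at h1
  rw [← Q.map_symm_map (Equiv.Set.univ I).symm p, h1, Q.map_symm_map]

variable {E : ℕ → Type} {X : Type}

/-- The value of a tree in the twisted algebra. -/
def treeVal (γ : ∀ k, E k → Q.Obj (Fin k)) (b : X → TwistedAlg Q I) : OpTree E X → TwistedAlg Q I
  | .leaf x => b x
  | .node (k := k) g c => op (γ k g) fun i => treeVal γ b (c i)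

theorem op_eval (γ : ∀ k, E k → Q.Obj (Fin k)) (b : X → TwistedAlg Q I) (t : OpTree E X) :
    op (eval γ t) (fun p => b (t.lab p)) = treeVal γ b t := by
  induction t with
  | leaf x => exact op_one _
  | node g c ih => exact (op_comp (γ _ g) _ _).trans (congrArg (op (γ _ g)) (funext ih))

theorem op_evalLin (γ : ∀ k, E k → Q.Obj (Fin k)) (b : K → TwistedAlg Q I) (t : OpTree E K)
    (ht : t.Linear) : op (evalLin γ t ht) b = treeVal γ b t := by
  rw [evalLin, op_map]
  exact op_eval γ b t

theorem op_freeHom_freeOf (γ : ∀ k, E k → Q.Obj (Fin k)) (b : K → TwistedAlg Q I)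
    (t : OpTree E K) (ht : t.Linear) :
    op ((freeHom γ).app K (freeOf R t ht)) b = treeVal γ b t := by
  rw [freeHom_freeOf, op_evalLin]

end SymOperad

/-! ## Sums over the decompositions of a list -/

section Splittings

variable {B C M M' : Type*} [AddCommMonoid M] [AddCommMonoid M']

/-- The sum of `f a b` over the decompositions `l = a ++ b`. -/
def sumSplit : List B → (List B → List B → M) → M
  | [], f => f [] []
  | y :: v, f => f [] (y :: v) + sumSplit v fun a b => f (y :: a) b

theorem sumSplit_nil (f : List B → List B → M) : sumSplit [] f = f [] [] := rfl

theorem sumSplit_cons (y : B) (v : List B) (f : List B → List B → M) :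
    sumSplit (y :: v) f = f [] (y :: v) + sumSplit v fun a b => f (y :: a) b := rfl

theorem sumSplit_add (v : List B) (f g : List B → List B → M) :
    (sumSplit v fun a b => f a b + g a b) = sumSplit v f + sumSplit v g := by
  induction v generalizing f g with
  | nil => rfl
  | cons y v ih =>
    simp only [sumSplit_cons, ih]
    abel

theorem sumSplit_zero (v : List B) : (sumSplit v fun _ _ => (0 : M)) = 0 := by
  induction v with
  | nil => rfl
  | cons y v ih => simp only [sumSplit_cons, ih, add_zero]

theorem map_sumSplit {F : Type*} [FunLike F M M'] [AddMonoidHomClass F M M'] (g : F) (v : List B)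
    (f : List B → List B → M) : g (sumSplit v f) = sumSplit v fun a b => g (f a b) := by
  induction v generalizing f with
  | nil => rfl
  | cons y v ih => simp only [sumSplit_cons, map_add, ih]

theorem sumSplit_concat (v : List B) (y : B) (f : List B → List B → M) :
    sumSplit (v ++ [y]) f = (sumSplit v fun a b => f a (b ++ [y])) + f (v ++ [y]) [] := by
  induction v generalizing f with
  | nil => rfl
  | cons x v ih => simp only [List.cons_append, sumSplit_cons, ih, add_assoc]

theorem sumSplit_append_cons (v : List B) (y : B) (u : List B) (f : List B → List B → M) :
    sumSplit (v ++ y :: u) f =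
      (sumSplit v fun a b => f a (b ++ y :: u)) + sumSplit u fun a b => f (v ++ y :: a) b := by
  induction v generalizing f with
  | nil => rfl
  | cons x v ih => simp only [List.cons_append, sumSplit_cons, ih, add_assoc]

/-- Coassociativity of deconcatenation: both sides run over the ways to cut the list into three
successive pieces. -/
theorem sumSplit_assoc (v : List B) (f : List B → List B → List B → M) :
    (sumSplit v fun a c => sumSplit a fun p q => f p q c) =
      sumSplit v fun p r => sumSplit r fun q c => f p q c := by
  induction v generalizing f with
  | nil => rfl
  | cons y v ih => simp only [sumSplit_cons, sumSplit_nil, sumSplit_add, ih, add_assoc]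

theorem sumSplit_comm (v : List B) (w : List C) (f : List B → List B → List C → List C → M) :
    (sumSplit v fun a b => sumSplit w fun c d => f a b c d) =
      sumSplit w fun c d => sumSplit v fun a b => f a b c d := by
  induction v generalizing f with
  | nil => rfl
  | cons y v ih => simp only [sumSplit_cons, sumSplit_add, ih]

theorem sumSplit_eq_left (v : List B) (f : List B → List B → M)
    (h : ∀ a b, a ≠ [] → f a b = 0) : sumSplit v f = f [] v := by
  cases v with
  | nil => rfl
  | cons y v =>
    rw [sumSplit_cons]
    simp only [h (y :: _) _ (List.cons_ne_nil _ _), sumSplit_zero, add_zero]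

theorem sumSplit_eq_right (v : List B) (f : List B → List B → M)
    (h : ∀ a b, b ≠ [] → f a b = 0) : sumSplit v f = f v [] := by
  induction v generalizing f with
  | nil => rfl
  | cons y v ih =>
    rw [sumSplit_cons, h _ _ (List.cons_ne_nil _ _), zero_add]
    exact ih _ fun a b hb => h _ _ hb

theorem sumSplit_eq_sum_range (v : List B) (f : List B → List B → M) :
    sumSplit v f = ∑ a ∈ Finset.range (v.length + 1), f (v.take a) (v.drop a) := by
  induction v generalizing f with
  | nil => simp [sumSplit_nil]
  | cons y v ih =>
    rw [sumSplit_cons, ih, List.length_cons, Finset.sum_range_succ' _ (v.length + 1), add_comm]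
    simp

end Splittings

/-! ## Dendriform algebras -/

/-- Dendriform algebras. -/
structure DendAlg (R : Type*) (A : Type*) [CommRing R] [AddCommGroup A] [Module R A] where
  lt : A →ₗ[R] A →ₗ[R] A
  gt : A →ₗ[R] A →ₗ[R] A
  lt_lt : ∀ x y z, lt (lt x y) z = lt x (lt y z) + lt x (gt y z)
  lt_gt : ∀ x y z, lt (gt x y) z = gt x (lt y z)
  gt_gt : ∀ x y z, gt x (gt y z) = gt (gt x y) z + gt (lt x y) z

namespace DendAlg

variable {R A : Type*} [CommRing R] [AddCommGroup A] [Module R A] (D : DendAlg R A)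

/-- The left action of the algebra `R × A` obtained by adjoining a unit. -/
def lact : (R × A) →ₗ[R] A →ₗ[R] A :=
  LinearMap.mk₂ R (fun u z => u.1 • z + D.gt u.2 z)
    (fun u v z => by simp only [Prod.fst_add, Prod.snd_add, map_add, LinearMap.add_apply]; module)
    (fun c u z => by
      simp only [Prod.smul_fst, Prod.smul_snd, map_smul, LinearMap.smul_apply]; module)
    (fun u z z' => by simp only [map_add]; module)
    (fun c u z => by simp only [map_smul]; module)

/-- The right action of the algebra `R × A` obtained by adjoining a unit. -/
def ract : A →ₗ[R] (R × A) →ₗ[R] A :=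
  LinearMap.mk₂ R (fun z u => u.1 • z + D.lt z u.2)
    (fun u z z' => by simp only [map_add, LinearMap.add_apply]; module)
    (fun c u z => by simp only [map_smul, LinearMap.smul_apply]; module)
    (fun u v z => by simp only [Prod.fst_add, Prod.snd_add, map_add]; module)
    (fun c u z => by simp only [Prod.smul_fst, Prod.smul_snd, map_smul]; module)

/-- The product of the algebra `R × A` obtained by adjoining a unit to `x * y = x ≺ y + x ≻ y`. -/
def mul : (R × A) →ₗ[R] (R × A) →ₗ[R] (R × A) :=
  LinearMap.mk₂ R (fun u v => (u.1 * v.1, D.ract u.2 v + D.lact u v.2))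
    (fun u v z => Prod.ext (add_mul _ _ _) (by
      simp only [Prod.snd_add, map_add, LinearMap.add_apply]; abel))
    (fun c u v => Prod.ext (mul_assoc _ _ _) (by
      simp only [Prod.smul_snd, map_smul, LinearMap.smul_apply, smul_add]))
    (fun u v z => Prod.ext (mul_add _ _ _) (by simp only [Prod.snd_add, map_add]; abel))
    (fun c u v => Prod.ext (mul_left_comm _ _ _) (by
      simp only [Prod.smul_snd, map_smul, smul_add]))

theorem lact_apply (u : R × A) (z : A) : D.lact u z = u.1 • z + D.gt u.2 z := rfl

theorem ract_apply (z : A) (u : R × A) : D.ract z u = u.1 • z + D.lt z u.2 := rfl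

theorem mul_apply (u v : R × A) : D.mul u v = (u.1 * v.1, D.ract u.2 v + D.lact u v.2) := rfl

theorem lact_one (z : A) : D.lact (1, 0) z = z := by simp [lact_apply]

theorem ract_one (z : A) : D.ract z (1, 0) = z := by simp [ract_apply]

theorem one_mul' (u : R × A) : D.mul (1, 0) u = u := by simp [mul_apply, lact_one]

theorem mul_one' (u : R × A) : D.mul u (1, 0) = u := by simp [mul_apply, ract_one]

/-- This law, `lact_mul` and `ract_mul` express one dendriform axiom each. Together they make A a
bimodule over the unital algebra R × A, and nearly all later computations use the axioms in this
form. -/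
theorem ract_lact (u : R × A) (z : A) (v : R × A) :
    D.ract (D.lact u z) v = D.lact u (D.ract z v) := by
  simp only [lact_apply, ract_apply, map_add, map_smul, LinearMap.add_apply,
    LinearMap.smul_apply, D.lt_gt]
  module

theorem lact_mul (u v : R × A) (z : A) : D.lact (D.mul u v) z = D.lact u (D.lact v z) := by
  simp only [mul_apply, lact_apply, ract_apply, map_add, map_smul, LinearMap.add_apply,
    LinearMap.smul_apply, D.gt_gt]
  module

theorem ract_mul (z : A) (u v : R × A) : D.ract z (D.mul u v) = D.ract (D.ract z u) v := by
  simp only [mul_apply, lact_apply, ract_apply, map_add, map_smul, LinearMap.add_apply,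
    LinearMap.smul_apply, D.lt_lt]
  module

/-! ### Iterated products and their convolution inverses -/

/-- The element `((x₁ ≻ x₂) ≻ ⋯) ≻ x_n`, which is the unit if the list is empty. -/
def word : List A → R × A
  | [] => (1, 0)
  | x :: l => (0, l.foldl (fun a b => D.gt a b) x)

/-- The element `(-1)^n x₁ ≺ (x₂ ≺ (⋯ ≺ x_n))`, which is the unit if the list is empty. -/
def coword : List A → R × A
  | [] => (1, 0)
  | x :: l => (0, -D.ract x (coword l))

theorem word_nil : D.word [] = (1, 0) := rfl

theorem coword_cons (x : A) (l : List A) : D.coword (x :: l) = (0, -D.ract x (D.coword l)) := rfl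

theorem word_concat (l : List A) (y : A) : D.word (l ++ [y]) = (0, D.lact (D.word l) y) := by
  cases l with
  | nil => simp [word, lact_one]
  | cons x l => simp [word, lact_apply]

theorem sumSplit_inr (v : List A) (f : List A → List A → A) :
    (sumSplit v fun a b => ((0, f a b) : R × A)) = (0, sumSplit v f) :=
  (map_sumSplit (LinearMap.inr R R A) v f).symm

theorem sumSplit_neg {B M : Type*} [AddCommGroup M] (v : List B) (f : List B → List B → M) :
    (sumSplit v fun a b => -f a b) = -sumSplit v f :=
  (map_sumSplit (negAddMonoidHom : M →+ M) v f).symm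

section

variable {B : Type*} (v : List B)

theorem sumSplit_lact (f : List B → List B → R × A) (z : A) :
    (sumSplit v fun a b => D.lact (f a b) z) = D.lact (sumSplit v f) z :=
  (map_sumSplit (D.lact.flip z) v f).symm

theorem sumSplit_lact' (u : R × A) (f : List B → List B → A) :
    (sumSplit v fun a b => D.lact u (f a b)) = D.lact u (sumSplit v f) :=
  (map_sumSplit (D.lact u) v f).symm

theorem sumSplit_ract (f : List B → List B → A) (u : R × A) :
    (sumSplit v fun a b => D.ract (f a b) u) = D.ract (sumSplit v f) u :=
  (map_sumSplit (D.ract.flip u) v f).symm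

theorem sumSplit_ract' (z : A) (f : List B → List B → R × A) :
    (sumSplit v fun a b => D.ract z (f a b)) = D.ract z (sumSplit v f) :=
  (map_sumSplit (D.ract z) v f).symm

end

/-- A telescoping sum. For the list y, v the cut with empty first piece gives s ≺ coword(yv) + s ≻
coword(yv). By induction the other cuts give (s ≻ y) · coword(v) = s ≻ (y · coword(v)), which is the
opposite of the second term. -/
theorem sumSplit_foldl_mul_coword (v : List A) (s : A) :
    (sumSplit v fun a b => D.mul (0, a.foldl (fun a b => D.gt a b) s) (D.coword b)) =
      (0, D.ract s (D.coword v)) := by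
  induction v generalizing s with
  | nil => simp [sumSplit_nil, coword, mul_one', ract_one]
  | cons y v ih =>
    simp only [sumSplit_cons, List.foldl_cons, List.foldl_nil, ih]
    simp only [coword_cons, mul_apply, Prod.mk_add_mk, lact_apply, map_neg,
      ract_apply _ (D.gt s y), D.lt_gt]
    ext
    · simp
    · simp only [ract_apply, map_add, map_smul, map_neg, zero_smul, zero_add]
      abel

/-- The convolution product of `word` and `coword` is trivial. -/
theorem sumSplit_word_mul_coword {v : List A} (hv : v ≠ []) :
    (sumSplit v fun a b => D.mul (D.word a) (D.coword b)) = 0 := by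
  cases v with
  | nil => exact (hv rfl).elim
  | cons y v =>
    simp only [sumSplit_cons, word, sumSplit_foldl_mul_coword]
    simp [one_mul', coword_cons]

/-- The inverse property on the other side, which makes braces vanish in the commutative case. The
statement has a last letter `s` because `word` grows at the end. -/
theorem sumSplit_coword_mul_word_concat (v : List A) (s : A) :
    (sumSplit (v ++ [s]) fun a b => D.mul (D.coword a) (D.word b)) = 0 := by
  -- Simultaneous induction on the length: the partial sum over the cuts before `s` needs both
  -- statements for shorter lists, and adding the last cut, whose term is the coword itself, gives
  -- the vanishing.
  have key : ∀ (n : ℕ) (v : List A) (s : A), v.length = n →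
      (sumSplit v fun a b => D.mul (D.coword a) (D.word (b ++ [s]))) = -D.coword (v ++ [s]) ∧
        (sumSplit (v ++ [s]) fun a b => D.mul (D.coword a) (D.word b)) = 0 := by
    intro n
    induction n with
    | zero =>
      intro v s hv
      obtain rfl := List.eq_nil_of_length_eq_zero hv
      simp [sumSplit_cons, sumSplit_nil, word, coword, one_mul', mul_one', ract_one]
    | succ n ih =>
      intro v s hv
      have h1 : (sumSplit v fun a b => D.mul (D.coword a) (D.word (b ++ [s]))) =
          -D.coword (v ++ [s]) := by
        have h2 : (sumSplit v fun a b => D.mul (D.coword a) (D.word b)) = 0 := by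
          rcases List.eq_nil_or_concat' v with rfl | ⟨u, z, rfl⟩
          · simp at hv
          · exact (ih u z (by simpa using hv)).2
        cases v with
        | nil => simp at hv
        | cons y v =>
          have h3 := (ih v s (by simpa using hv)).1
          -- The product is split into its ≻ part and its ≺ part. By the vanishing for `v`, the ≻
          -- parts sum to zero.
          have h4 : ∀ a b : List A, D.mul (D.coword a) (D.word (b ++ [s])) =
              (0, D.lact (D.mul (D.coword a) (D.word b)) s) +
                (0, D.lt (D.coword a).2 (D.lact (D.word b) s)) := by
            intro a b
            rw [word_concat, lact_mul, mul_apply, Prod.mk_add_mk, ract_apply]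
            simp [add_comm]
          -- In the ≺ part the cut with empty first piece contributes nothing, since the unit has
          -- zero component in A. For the others the first letter `y` factors out and the shorter
          -- list takes over.
          have h5 : ∀ a b : List A, D.lt (D.coword (y :: a)).2 (D.lact (D.word b) s) =
              -D.ract y (D.mul (D.coword a) (D.word (b ++ [s]))) := by
            intro a b
            rw [coword_cons, word_concat, ract_mul]
            simp [ract_apply]
          simp only [h4, sumSplit_add, sumSplit_inr]
          rw [sumSplit_lact, h2, map_zero, LinearMap.zero_apply, sumSplit_cons]
          simp only [h5, sumSplit_neg, sumSplit_ract', h3]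
          simp [coword]
      refine ⟨h1, ?_⟩
      rw [sumSplit_concat, h1]
      simp [word, mul_one']
  exact (key _ v s rfl).2


/-- The brace `{z ∣ l}`. -/
def brace (z : A) (l : List A) : A :=
  sumSplit l fun a b => D.lact (D.coword a) (D.ract z (D.word b))

theorem brace_nil (z : A) : D.brace z [] = z := by
  simp [brace, sumSplit_nil, coword, word, lact_one, ract_one]

/-! ### Words shuffled with brackets, and their deconcatenation -/

section Shuffle

variable {M M' : Type*} [AddCommMonoid M] [AddCommMonoid M']

/-- The sum of `F u` over the words `u = V₀, {x₁ ∣ V₁}, V₂, …, {x_n ∣ V_{2n-1}}, V_{2n}`, where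
`x₁, …, x_n` is the first list and `V₀, …, V_{2n}` are the decompositions of the second one. -/
def sumShuffle : List A → List A → (List A → M) → M
  | [], v, F => F v
  | x :: w, v, F => sumSplit v fun a r => sumSplit r fun b c =>
      sumShuffle w c fun u => F (a ++ D.brace x b :: u)

theorem sumShuffle_cons (x : A) (w v : List A) (F : List A → M) :
    D.sumShuffle (x :: w) v F = sumSplit v fun a r => sumSplit r fun b c =>
      D.sumShuffle w c fun u => F (a ++ D.brace x b :: u) := rfl

theorem map_sumShuffle {G : Type*} [FunLike G M M'] [AddMonoidHomClass G M M'] (g : G)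
    (w v : List A) (F : List A → M) :
    g (D.sumShuffle w v F) = D.sumShuffle w v fun u => g (F u) := by
  induction w generalizing v F with
  | nil => rfl
  | cons x w ih => simp only [sumShuffle_cons, map_sumSplit, ih]

theorem sumShuffle_add (w v : List A) (F G : List A → M) :
    (D.sumShuffle w v fun u => F u + G u) = D.sumShuffle w v F + D.sumShuffle w v G := by
  induction w generalizing v F G with
  | nil => rfl
  | cons x w ih => simp only [sumShuffle_cons, sumSplit_add, ih]

theorem sumShuffle_inr (w v : List A) (F : List A → A) :
    (D.sumShuffle w v fun u => ((0, F u) : R × A)) = (0, D.sumShuffle w v F) :=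
  (D.map_sumShuffle (LinearMap.inr R R A) w v F).symm

theorem sumShuffle_neg (w v : List A) (F : List A → A) :
    (D.sumShuffle w v fun u => -F u) = -D.sumShuffle w v F :=
  (D.map_sumShuffle (negAddMonoidHom : A →+ A) w v F).symm

theorem sumShuffle_lact (w v : List A) (F : List A → R × A) (z : A) :
    (D.sumShuffle w v fun u => D.lact (F u) z) = D.lact (D.sumShuffle w v F) z :=
  (D.map_sumShuffle (D.lact.flip z) w v F).symm

theorem sumShuffle_lact' (w v : List A) (y : R × A) (F : List A → A) :
    (D.sumShuffle w v fun u => D.lact y (F u)) = D.lact y (D.sumShuffle w v F) :=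
  (D.map_sumShuffle (D.lact y) w v F).symm

theorem sumShuffle_ract' (w v : List A) (z : A) (F : List A → R × A) :
    (D.sumShuffle w v fun u => D.ract z (F u)) = D.ract z (D.sumShuffle w v F) :=
  (D.map_sumShuffle (D.ract z) w v F).symm

theorem sumShuffle_sumSplit_comm {B : Type*} (w v : List A) (l : List B)
    (F : List A → List B → List B → M) :
    (D.sumShuffle w v fun u => sumSplit l (F u)) =
      sumSplit l fun a b => D.sumShuffle w v fun u => F u a b := by
  induction w generalizing v F with
  | nil => rfl
  | cons x w ih =>
    simp only [sumShuffle_cons, ih]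
    rw [sumSplit_comm l v]
    exact congrArg _ (funext₂ fun a r => sumSplit_comm r l _)

/-- The definition peels off the first bracket, which suits `coword`. This is the mirror form that
peels off the last one, needed for `word`, whose recursion is at the end of the list. -/
theorem sumShuffle_concat (w : List A) (x : A) (v : List A) (F : List A → M) :
    D.sumShuffle (w ++ [x]) v F = sumSplit v fun a r => sumSplit r fun b c =>
      D.sumShuffle w a fun u => F (u ++ D.brace x b :: c) := by
  induction w generalizing v F with
  | nil => rfl
  | cons y w ih =>
    simp only [List.cons_append, sumShuffle_cons, ih, List.append_assoc]
    symm
    refine Eq.trans (congrArg (sumSplit v) (funext₂ fun m t => sumSplit_comm t m _)) ?_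
    refine (sumSplit_assoc v _).trans (congrArg (sumSplit v) (funext₂ fun p s => ?_))
    refine Eq.trans (congrArg (sumSplit s) (funext₂ fun r t => sumSplit_comm t r _)) ?_
    exact sumSplit_assoc s _

/-- Deconcatenation of the words of a shuffle. -/
theorem sumShuffle_sumSplit (w v : List A) (G : List A → List A → M) :
    (D.sumShuffle w v fun u => sumSplit u G) =
      sumSplit w fun w₁ w₂ => sumSplit v fun v₁ v₂ =>
        D.sumShuffle w₁ v₁ fun u₁ => D.sumShuffle w₂ v₂ fun u₂ => G u₁ u₂ := by
  induction w generalizing v G with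
  | nil => rfl
  | cons x w ih =>
    rw [sumSplit_cons]
    simp only [sumShuffle_cons, sumSplit_append_cons, sumShuffle_add, sumSplit_add, ih]
    congr 1
    -- The cut falls before the first bracket: no letter of `w` lies to its left, and V₀ is divided.
    · simp only [sumShuffle_sumSplit_comm]
      refine Eq.trans (congrArg (sumSplit v) (funext₂ fun a r => ?_)) (sumSplit_assoc v _)
      exact sumSplit_comm r a _
    -- The cut falls after the first bracket, and the induction hypothesis divides the remaining
    -- word. What is left is to reorder the sums over the cuts of `v`.
    · symm
      refine (sumSplit_comm w v _).trans ?_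
      refine Eq.trans (congrArg (sumSplit v) (funext₂ fun m d => sumSplit_comm w m _)) ?_
      refine (sumSplit_assoc v _).trans (congrArg (sumSplit v) (funext₂ fun a r => ?_))
      refine Eq.trans (congrArg (sumSplit r) (funext₂ fun m d => sumSplit_comm w m _)) ?_
      refine (sumSplit_assoc r _).trans (congrArg (sumSplit r) (funext₂ fun b c => ?_))
      exact sumSplit_comm c w _

end Shuffle

/-- A brace is conjugation, coword · x · word. Multiplying on the right by a further coword cancels
the word factor by the inverse property, so only the left factor survives. -/
theorem sumSplit_ract_brace_coword (x : A) (v : List A) :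
    (sumSplit v fun b c => D.ract (D.brace x b) (D.coword c)) = D.lact (D.coword v) x := by
  simp only [brace, ← sumSplit_ract, ract_lact, ← ract_mul]
  rw [sumSplit_assoc]
  simp only [sumSplit_lact', sumSplit_ract']
  rw [sumSplit_eq_right]
  · simp [sumSplit_nil, word, coword, one_mul', ract_one]
  · intro a b hb
    rw [D.sumSplit_word_mul_coword hb, map_zero, map_zero]

/-- Mirror image of `sumSplit_ract_brace_coword`: here the left factor is cancelled. -/
theorem sumSplit_lact_word_brace (x : A) (v : List A) :
    (sumSplit v fun a b => D.lact (D.word a) (D.brace x b)) = D.ract x (D.word v) := by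
  simp only [brace, ← sumSplit_lact', ← lact_mul]
  rw [← sumSplit_assoc]
  simp only [sumSplit_lact]
  rw [sumSplit_eq_left]
  · simp [sumSplit_nil, word, coword, one_mul', lact_one]
  · intro a b ha
    rw [D.sumSplit_word_mul_coword ha, map_zero, LinearMap.zero_apply]

/-- Sort the words by their first letter, which is either the first letter of `v` or a bracket {x ∣
b}. These two families give the ≺ part and the ≻ part of the product coword(v) * coword(w). -/
theorem sumShuffle_coword (w v : List A) :
    D.sumShuffle w v D.coword = D.mul (D.coword v) (D.coword w) := by
  induction w generalizing v with
  | nil => exact (D.mul_one' _).symm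
  | cons x w ih =>
    -- Words that start with the bracket: `sumSplit_ract_brace_coword` removes the bracket and
    -- leaves coword(v) acting on the left.
    have h0 : ∀ v : List A, (sumSplit v fun b c => D.sumShuffle w c fun u =>
        D.coword (D.brace x b :: u)) = (0, D.lact (D.coword v) (D.coword (x :: w)).2) := by
      intro v
      simp only [coword_cons, sumShuffle_inr, sumShuffle_neg, sumShuffle_ract', ih, ract_mul,
        sumSplit_inr, sumSplit_neg, sumSplit_ract, sumSplit_ract_brace_coword, ract_lact, map_neg]
    induction v with
    | nil =>
      refine (h0 []).trans ?_
      simp [coword, one_mul', lact_one]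
    | cons y v ihv =>
      rw [sumShuffle_cons, sumSplit_cons]
      simp only [List.nil_append, h0, List.cons_append, D.coword_cons y, sumShuffle_inr,
        sumShuffle_neg, sumShuffle_ract', sumSplit_inr, sumSplit_neg, sumSplit_ract']
      rw [← sumShuffle_cons, ihv]
      -- The words starting with `y` gave -y · (coword(v) * coword(xw)), which by `ract_mul` is
      -- coword(yv) ≺ coword(xw).
      rw [ract_mul, D.coword_cons x w]
      generalize -D.ract x (D.coword w) = t
      simp [mul_apply, add_comm]

/-- The mirror argument, by last letters: a final letter of `v` gives the ≻ part of the product, a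
final bracket the ≺ part. The order of the factors is therefore opposite to that in
`sumShuffle_coword`. -/
theorem sumShuffle_word (w v : List A) :
    D.sumShuffle w v D.word = D.mul (D.word w) (D.word v) := by
  induction w using List.reverseRecOn generalizing v with
  | nil => exact (D.one_mul' _).symm
  | append_singleton w x ih =>
    have h0 : ∀ v : List A, (sumSplit v fun a b => D.sumShuffle w a fun u =>
        D.word (u ++ [D.brace x b])) = (0, D.ract (D.word (w ++ [x])).2 (D.word v)) := by
      intro v
      simp only [word_concat, sumShuffle_inr, sumShuffle_lact, ih, lact_mul,
        sumSplit_inr, sumSplit_lact', sumSplit_lact_word_brace, ract_lact]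
    induction v using List.reverseRecOn with
    | nil =>
      rw [sumShuffle_concat]
      refine (h0 []).trans ?_
      rw [word_concat]
      simp only [word_nil, mul_one', ract_one]
    | append_singleton v y ihv =>
      -- The outer cut is moved to the piece after the last bracket, which either ends in `y` or is
      -- empty.
      rw [sumShuffle_concat, ← sumSplit_assoc, sumSplit_concat]
      have h1 : ∀ (u b c : List A), D.word (u ++ D.brace x b :: (c ++ [y])) =
          (0, D.lact (D.word (u ++ D.brace x b :: c)) y) := fun u b c => by
        rw [← word_concat, List.append_assoc, List.cons_append]
      simp only [h0, h1, sumShuffle_inr, sumShuffle_lact, sumSplit_inr, sumSplit_lact]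
      rw [sumSplit_assoc, ← sumShuffle_concat, ihv, word_concat, word_concat, lact_mul]
      generalize D.lact (D.word v) y = t
      simp [mul_apply, add_comm]

/-- The brace relation. -/
theorem brace_brace (z : A) (w v : List A) :
    D.brace (D.brace z w) v = D.sumShuffle w v (D.brace z) := by
  symm
  refine (D.sumShuffle_sumSplit w v _).trans ?_
  simp only [sumShuffle_lact', sumShuffle_lact, sumShuffle_ract', sumShuffle_coword,
    sumShuffle_word, lact_mul, ract_mul]
  -- Each term is now coword(v₁) · coword(w₁) · z · word(w₂) · word(v₂). Summing the inner part over
  -- the cuts of `w` produces the inner brace, and the cuts of `v` produce the outer one.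
  rw [sumSplit_comm]
  simp only [brace, ← sumSplit_ract, ← sumSplit_lact', ract_lact]

end DendAlg

/-! ### Successive intervals: monotone maps against iterated cuts -/

section Pieces

variable {B M : Type*} [AddCommMonoid M]

/-- The sum of `F L` over the decompositions `L` of a list into `N + 1` successive pieces. -/
def sumPieces : ℕ → List B → (List (List B) → M) → M
  | 0, v, F => F [v]
  | N + 1, v, F => sumSplit v fun a r => sumPieces N r fun L => F (a :: L)

theorem sumPieces_succ (N : ℕ) (v : List B) (F : List (List B) → M) :
    sumPieces (N + 1) v F = sumSplit v fun a r => sumPieces N r fun L => F (a :: L) := rfl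

/-- The blocks of a list, for a map from its positions to a finite ordinal. -/
def blocks {m N : ℕ} (f : Fin m → Fin N) (y : Fin m → B) : List (List B) :=
  List.ofFn fun k => ((List.finRange m).filter fun j => f j = k).map y

theorem blocks_succ_comp {m N : ℕ} (f : Fin m → Fin N) (y : Fin m → B) :
    blocks (fun j => (f j).succ) y = [] :: blocks f y := by
  rw [blocks, List.ofFn_succ]
  simp only [Fin.succ_ne_zero, decide_false, List.filter_false, List.map_nil, Fin.succ_inj]
  rfl

/-- Adding a letter to the first list. -/
def consHead (y : B) : List (List B) → List (List B)
  | [] => []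
  | b :: L => (y :: b) :: L

theorem blocks_cons_zero {m N : ℕ} (f : Fin m → Fin (N + 1)) (y : Fin (m + 1) → B) :
    blocks (Fin.cons 0 f : Fin (m + 1) → Fin (N + 1)) y =
      consHead (y 0) (blocks f fun j => y j.succ) := by
  have h : ∀ k, ((List.finRange (m + 1)).filter fun j =>
      (Fin.cons 0 f : Fin (m + 1) → Fin (N + 1)) j = k).map y =
      (if 0 = k then [y 0] else []) ++
        ((List.finRange m).filter fun j => f j = k).map fun j => y j.succ := by
    intro k
    rw [List.finRange_succ, List.filter_cons, List.filter_map]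
    by_cases hk : 0 = k <;> simp [hk, Function.comp_def]
  rw [blocks, blocks, List.ofFn_succ, List.ofFn_succ]
  simp only [h, consHead, if_pos, List.singleton_append]
  congr 2

theorem monotone_cons_zero {m N : ℕ} {f : Fin m → Fin (N + 1)} (hf : Monotone f) :
    Monotone (Fin.cons 0 f : Fin (m + 1) → Fin (N + 1)) := by
  intro i j hij
  induction i using Fin.cases with
  | zero => simp
  | succ i =>
    induction j using Fin.cases with
    | zero => simp at hij
    | succ j => simpa using hf (Fin.succ_le_succ_iff.1 hij)

/-- Bridge between the presentation of Brace, whose relations sum over monotone maps, and the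
recursive sums used for dendriform algebras. The two cases of the recursion for cuts correspond to
the first block being empty or containing the first letter. -/
theorem sum_blocks_eq_sumPieces (N : ℕ) {m : ℕ} (y : Fin m → B) (F : List (List B) → M) :
    ∑ f : {f : Fin m → Fin (N + 1) // Monotone f}, F (blocks f.1 y) =
      sumPieces N (List.ofFn y) F := by
  induction N generalizing m F with
  | zero =>
    have : Unique {f : Fin m → Fin (0 + 1) // Monotone f} :=
      ⟨⟨⟨fun _ => 0, monotone_const⟩⟩, fun f =>
        Subtype.ext (funext fun j => Subsingleton.elim (α := Fin 1) _ _)⟩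
    rw [Fintype.sum_unique, sumPieces, blocks, List.ofFn_succ, List.ofFn_zero, List.ofFn_eq_map]
    simp [Subsingleton.elim _ (0 : Fin 1)]
  | succ N ih =>
    induction m generalizing F with
    | zero =>
      have : Unique {f : Fin 0 → Fin (N + 1 + 1) // Monotone f} :=
        ⟨⟨⟨Fin.elim0, fun i => i.elim0⟩⟩, fun f => Subtype.ext (Subsingleton.elim _ _)⟩
      have : Unique {f : Fin 0 → Fin (N + 1) // Monotone f} :=
        ⟨⟨⟨Fin.elim0, fun i => i.elim0⟩⟩, fun f => Subtype.ext (Subsingleton.elim _ _)⟩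
      have h := ih y fun L => F ([] :: L)
      rw [List.ofFn_zero] at h
      rw [Fintype.sum_unique, sumPieces_succ, List.ofFn_zero, sumSplit_nil, ← h,
        Fintype.sum_unique, ← blocks_succ_comp]
      exact congrArg (fun f => F (blocks f y)) (Subsingleton.elim _ _)
    | succ m ihm =>
      -- A monotone map either avoids 0 and is a shifted map to a smaller ordinal, or sends the
      -- first letter to 0 and is arbitrary monotone on the others.
      let Φ : ({f : Fin (m + 1) → Fin (N + 1) // Monotone f} ⊕
          {f : Fin m → Fin (N + 1 + 1) // Monotone f}) →
          {f : Fin (m + 1) → Fin (N + 1 + 1) // Monotone f} :=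
        Sum.elim (fun f => ⟨fun j => (f.1 j).succ, fun i j h => Fin.succ_le_succ_iff.2 (f.2 h)⟩)
          fun f => ⟨Fin.cons 0 f.1, monotone_cons_zero f.2⟩
      have hΦ : Function.Bijective Φ := by
        constructor
        · rintro (⟨f, hf⟩ | ⟨f, hf⟩) (⟨g, hg⟩ | ⟨g, hg⟩) h
          · have h1 := congrArg Subtype.val h
            congr 2
            exact funext fun j => Fin.succ_injective _ (congrFun h1 j)
          · exact (Fin.succ_ne_zero _ (congrFun (congrArg Subtype.val h) 0)).elim
          · exact (Fin.succ_ne_zero _ (congrFun (congrArg Subtype.val h) 0).symm).elim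
          · have h1 := congrArg Subtype.val h
            congr 2
            exact funext fun j => congrFun h1 j.succ
        · rintro ⟨f, hf⟩
          by_cases h0 : f 0 = 0
          · refine ⟨Sum.inr ⟨fun j => f j.succ, fun i j h => hf (Fin.succ_le_succ_iff.2 h)⟩,
              Subtype.ext (funext fun j => ?_)⟩
            induction j using Fin.cases with
            | zero => exact h0.symm
            | succ j => rfl
          · have h1 : ∀ j, f j ≠ 0 := fun j hj =>
              h0 (le_antisymm ((hf (Fin.zero_le j)).trans hj.le) (Fin.zero_le _))
            exact ⟨Sum.inl ⟨fun j => (f j).pred (h1 j), fun i j h => Fin.pred_le_pred_iff.2 (hf h)⟩,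
              Subtype.ext (funext fun j => Fin.succ_pred _ (h1 j))⟩
      rw [← Fintype.sum_bijective Φ hΦ _ _ fun _ => rfl, Fintype.sum_sum_type, List.ofFn_succ,
        sumPieces_succ, sumSplit_cons]
      congr 1
      · rw [← List.ofFn_succ, ← ih]
        exact Finset.sum_congr rfl fun f _ => congrArg F (blocks_succ_comp f.1 y)
      · refine Eq.trans ?_ (ihm (fun j => y j.succ) fun L => F (consHead (y 0) L))
        exact Finset.sum_congr rfl fun f _ => congrArg F (blocks_cons_zero f.1 y)

end Pieces

/-! ### Explicit form of the shuffles; vanishing of braces -/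

namespace DendAlg

variable {R A : Type*} [CommRing R] [AddCommGroup A] [Module R A] (D : DendAlg R A)

/-- The word `V₀, {x₁ ∣ V₁}, V₂, …, {x_n ∣ V_{2n-1}}, V_{2n}`. -/
def interleave : List A → List (List A) → List A
  | [], L => L.headD []
  | x :: w, L => L.headD [] ++ D.brace x (L.tail.headD []) :: interleave w L.tail.tail

/-- Each bracket uses two cuts, one where it opens and one where it closes, so n brackets cut `v`
into 2n + 1 pieces. -/
theorem sumShuffle_eq_sumPieces {M : Type*} [AddCommMonoid M] (w v : List A) (F : List A → M) :
    D.sumShuffle w v F = sumPieces (2 * w.length) v fun L => F (D.interleave w L) := by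
  induction w generalizing v F with
  | nil => rfl
  | cons x w ih =>
    simp only [sumShuffle_cons, ih]
    rfl

theorem interleave_ofFn {n : ℕ} (x : Fin n → A) (V : ℕ → List A) :
    D.interleave (List.ofFn x) (List.ofFn fun k : Fin (2 * n + 1) => V k) =
      V 0 ++ (List.finRange n).flatMap fun i : Fin n =>
        D.brace (x i) (V (2 * i + 1)) :: V (2 * i + 2) := by
  induction n generalizing V with
  | zero => simp [interleave]
  | succ n ih =>
    -- Removing the first bracket consumes the two pieces V₀ and V₁, hence the shift by two;
    -- indexing `V` by all natural numbers lets it be shifted freely.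
    have h := ih (fun i => x i.succ) fun k => V (k + 2)
    rw [List.ofFn_succ, interleave, show 2 * (n + 1) + 1 = (2 * n + 1) + 1 + 1 from rfl,
      List.ofFn_succ, List.ofFn_succ]
    simp only [List.tail_cons, List.headD_cons, Fin.val_succ, add_assoc]
    refine (congrArg (fun l => V 0 ++ D.brace (x 0) (V 1) :: l) h).trans ?_
    simp [List.finRange_succ, List.flatMap_map, mul_add, add_right_comm, add_assoc]

/-- If `x ≻ y = y ≺ x`, then the braces vanish. -/
theorem brace_eq_zero (h : ∀ x y, D.gt x y = D.lt y x) (z : A) {l : List A} (hl : l ≠ []) :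
    D.brace z l = 0 := by
  have h1 : ∀ u z, D.lact u z = D.ract z u := fun u z => by rw [lact_apply, ract_apply, h]
  have h2 : ∀ u v, D.mul u v = D.mul v u := fun u v => by
    rw [mul_apply, mul_apply, h1, h1, mul_comm, add_comm]
  rcases List.eq_nil_or_concat' l with rfl | ⟨l, s, rfl⟩
  · exact (hl rfl).elim
  -- Both actions move to the right of `z` and the two factors commute, so the brace is `z` times a
  -- convolution that vanishes on nonempty lists.
  · simp only [brace, h1, ← ract_mul, h2 (D.word _), sumSplit_ract']
    rw [sumSplit_coword_mul_word_concat, map_zero]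

end DendAlg

namespace SymOperad

variable {R : Type u} [CommRing R] {Q : SymOperad.{u, v} R} {I X : Type} [Finite I]

/-! ## Binary operations and dendriform structures on the twisted algebra -/

/-- The bilinear product on the twisted algebra defined by a binary operation. -/
def binOp (q : Q.Obj (Fin 2)) : TwistedAlg Q I →ₗ[R] TwistedAlg Q I →ₗ[R] TwistedAlg Q I :=
  have h0 (a b c : TwistedAlg Q I) : Function.update ![a, b] 0 c = ![c, b] := by
    ext i : 1; fin_cases i <;> simp
  have h1 (a b c : TwistedAlg Q I) : Function.update ![a, b] 1 c = ![a, c] := by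
    ext i : 1; fin_cases i <;> simp
  LinearMap.mk₂ R (fun a b => op q ![a, b])
    (fun a a' b => by simpa only [h0] using (op q).map_update_add ![a, b] 0 a a')
    (fun c a b => by simpa only [h0] using (op q).map_update_smul ![a, b] 0 c a)
    (fun a b b' => by simpa only [h1] using (op q).map_update_add ![a, b] 1 b b')
    (fun c a b => by simpa only [h1] using (op q).map_update_smul ![a, b] 1 c b)

theorem binOp_apply (q : Q.Obj (Fin 2)) (a b : TwistedAlg Q I) : binOp q a b = op q ![a, b] := rfl

theorem op_eq_binOp (q : Q.Obj (Fin 2)) (a : Fin 2 → TwistedAlg Q I) :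
    op q a = binOp q (a 0) (a 1) := by
  rw [binOp_apply]
  congr 1
  ext i : 1; fin_cases i <;> rfl

theorem binOp_sub (p q : Q.Obj (Fin 2)) (a b : TwistedAlg Q I) :
    binOp (p - q) a b = binOp p a b - binOp q a b :=
  map_sub (opLin ![a, b]) p q

theorem binOp_swap (q : Q.Obj (Fin 2)) (a b : TwistedAlg Q I) :
    binOp (Q.map (Equiv.swap 0 1) q) a b = binOp q b a := by
  rw [binOp_apply, op_map, op_eq_binOp]
  simp

theorem treeVal_node_two {E : ℕ → Type} (γ : ∀ k, E k → Q.Obj (Fin k)) (b : X → TwistedAlg Q I)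
    (g : E 2) (s t : OpTree E X) :
    treeVal γ b (.node g ![s, t]) = binOp (γ 2 g) (treeVal γ b s) (treeVal γ b t) :=
  op_eq_binOp _ _

/-- A relation of the free operad holds in `Q` as soon as its value on the generators of the twisted
algebra vanishes. -/
theorem freeHom_eq_zero {E : ℕ → Type} {γ : ∀ k, E k → Q.Obj (Fin k)}
    {r : (freeOperad R E).Obj I} (h : opLin (I := I) gen ((freeHom γ).app I r) = 0) :
    (freeHom γ).app I r = 0 :=
  eq_of_op_gen_eq (h.trans (map_zero (opLin (Q := Q) (I := I) gen)).symm)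

theorem opLin_freeHom_freeOf {K : Type} [Finite K] {E : ℕ → Type} (γ : ∀ k, E k → Q.Obj (Fin k))
    (b : K → TwistedAlg Q I) (t : OpTree E K) (ht : t.Linear) :
    opLin b ((freeHom γ).app K (freeOf R t ht)) = treeVal γ b t :=
  op_freeHom_freeOf γ b t ht

theorem opLin_freeHom_eq_zero {K : Type} [Finite K] {E : ℕ → Type} {γ : ∀ k, E k → Q.Obj (Fin k)}
    {r : (freeOperad R E).Obj K} (h : (freeHom γ).app K r = 0) (b : K → TwistedAlg Q I) :
    opLin b ((freeHom γ).app K r) = 0 := by rw [h, map_zero]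

/-- The values of the generators of `Dend`. -/
def dendGens (p s : Q.Obj (Fin 2)) : ∀ k, DendGen k → Q.Obj (Fin k)
  | _, .prec => p
  | _, .succ => s

/-- The value of a binary generator. -/
def binaryGen (p : Q.Obj (Fin 2)) : ∀ k, OneBinary k → Q.Obj (Fin k)
  | _, .mul => p

theorem treeVal_prod (p : Q.Obj (Fin 2)) (b : X → TwistedAlg Q I) (s t : OpTree OneBinary X) :
    treeVal (binaryGen p) b (OneBinary.prod s t) =
      binOp p (treeVal (binaryGen p) b s) (treeVal (binaryGen p) b t) :=
  treeVal_node_two _ b _ s t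

theorem opLin_left (p : Q.Obj (Fin 2)) (b : Fin 3 → TwistedAlg Q I)
    (i j k : Fin 3) (h : ([i, j, k] : List (Fin 3)).Nodup ∧ ∀ x, x ∈ [i, j, k]) :
    opLin b ((freeHom (binaryGen p)).app (Fin 3) (OneBinary.left R i j k h)) =
      binOp p (binOp p (b i) (b j)) (b k) := by
  refine (opLin_freeHom_freeOf _ b _ _).trans ?_
  simp only [treeVal_prod, treeVal]

theorem opLin_right (p : Q.Obj (Fin 2)) (b : Fin 3 → TwistedAlg Q I)
    (i j k : Fin 3) (h : ([i, j, k] : List (Fin 3)).Nodup ∧ ∀ x, x ∈ [i, j, k]) :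
    opLin b ((freeHom (binaryGen p)).app (Fin 3) (OneBinary.right R i j k h)) =
      binOp p (b i) (binOp p (b j) (b k)) := by
  refine (opLin_freeHom_freeOf _ b _ _).trans ?_
  simp only [treeVal_prod, treeVal]

theorem treeVal_lt (γ : ∀ k, DendGen k → Q.Obj (Fin k)) (b : X → TwistedAlg Q I)
    (s t : OpTree DendGen X) :
    treeVal γ b (DendGen.lt s t) = binOp (γ 2 .prec) (treeVal γ b s) (treeVal γ b t) :=
  treeVal_node_two _ b _ s t

theorem treeVal_gt (γ : ∀ k, DendGen k → Q.Obj (Fin k)) (b : X → TwistedAlg Q I)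
    (s t : OpTree DendGen X) :
    treeVal γ b (DendGen.gt s t) = binOp (γ 2 .succ) (treeVal γ b s) (treeVal γ b t) :=
  treeVal_node_two _ b _ s t

/-- The dendriform structure on the twisted algebra over an operad with operations that satisfy the
dendriform relations. -/
def twistedDendAlg {γ : ∀ k, DendGen k → Q.Obj (Fin k)}
    (h : ∀ (I : Type) [Finite I] (r : (freeOperad R DendGen).Obj I), DendRel R I r →
      (freeHom γ).app I r = 0) (I : Type) [Finite I] : DendAlg R (TwistedAlg Q I) where
  lt := binOp (γ 2 .prec)
  gt := binOp (γ 2 .succ)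
  lt_lt x y z := by
    have h1 := opLin_freeHom_eq_zero (h _ _ DendRel.prec_prec) ![x, y, z]
    simp only [map_sub, map_add, opLin_freeHom_freeOf, treeVal_lt, treeVal_gt, treeVal] at h1
    exact sub_eq_zero.1 h1
  lt_gt x y z := by
    have h1 := opLin_freeHom_eq_zero (h _ _ DendRel.succ_prec) ![x, y, z]
    simp only [map_sub, opLin_freeHom_freeOf, treeVal_lt, treeVal_gt, treeVal] at h1
    exact sub_eq_zero.1 h1
  gt_gt x y z := by
    have h1 := opLin_freeHom_eq_zero (h _ _ DendRel.succ_succ) ![x, y, z]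
    simp only [map_sub, map_add, opLin_freeHom_freeOf, treeVal_lt, treeVal_gt, treeVal] at h1
    exact sub_eq_zero.1 h1

/-! ### Values of the trees that occur in ψ -/

section Trees

open DendGen

variable {γ : ∀ k, DendGen k → Q.Obj (Fin k)}
    (h : ∀ (I : Type) [Finite I] (r : (freeOperad R DendGen).Obj I), DendRel R I r →
      (freeHom γ).app I r = 0) (b : X → TwistedAlg Q I)

theorem treeVal_ltSearrow (t : OpTree DendGen X) (l : List (OpTree DendGen X)) :
    treeVal γ b (ltSearrow t l) =
      (twistedDendAlg h I).ract (treeVal γ b t)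
        ((twistedDendAlg h I).word (l.map (treeVal γ b))) := by
  cases l with
  | nil => exact ((twistedDendAlg h I).ract_one _).symm
  | cons x l =>
    have h1 : ∀ x, treeVal γ b (searrow x l) =
        (l.map (treeVal γ b)).foldl (fun a b => (twistedDendAlg h I).gt a b) (treeVal γ b x) := by
      induction l with
      | nil => exact fun x => rfl
      | cons y l ih =>
        intro x
        refine (ih (gt x y)).trans ?_
        rw [treeVal_gt]
        rfl
    simp only [ltSearrow, treeVal_lt, h1, List.map_cons, DendAlg.word, DendAlg.ract_apply,
      zero_smul, zero_add]
    rfl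

/-- The sign of the alternating sum is absorbed by `coword`, one factor -1 per letter, and the
convention for the empty list is the action of the unit. -/
theorem treeVal_nearrowGt (t : OpTree DendGen X) (l : List (OpTree DendGen X)) :
    (-1 : R) ^ l.length • treeVal γ b (nearrowGt t l) =
      (twistedDendAlg h I).lact ((twistedDendAlg h I).coword (l.map (treeVal γ b)))
        (treeVal γ b t) := by
  cases l with
  | nil => simp [nearrowGt, DendAlg.coword, DendAlg.lact_one]
  | cons x l =>
    have h1 : ∀ x, (twistedDendAlg h I).coword ((x :: l).map (treeVal γ b)) =
        (0, (-1 : R) ^ (l.length + 1) • treeVal γ b (nearrow x l)) := by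
      induction l with
      | nil =>
        intro x
        simp [DendAlg.coword, DendAlg.ract_one, nearrow]
      | cons y l ih =>
        intro x
        rw [List.map_cons, DendAlg.coword_cons, ih, DendAlg.ract_apply, zero_smul, zero_add,
          nearrow, treeVal_lt, map_smul, List.length_cons, pow_succ _ (l.length + 1), mul_neg_one,
          neg_smul]
        rfl
    rw [h1, DendAlg.lact_apply, zero_smul, zero_add, map_smul, LinearMap.smul_apply, nearrowGt,
      treeVal_gt]
    rfl

/-- The alternating sum of the values of the trees `psiTree n a` is a brace. -/
theorem sum_treeVal_psiTree (n : ℕ) (b : Fin (n + 1) → TwistedAlg Q I) :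
    ∑ a ∈ Finset.range (n + 1), (-1 : R) ^ a • treeVal γ b (psiTree n a) =
      (twistedDendAlg h I).brace (b 0) (List.ofFn fun j : Fin n => b j.succ) := by
  rw [DendAlg.brace, sumSplit_eq_sum_range, List.length_ofFn]
  refine Finset.sum_congr rfl fun a ha => ?_
  have ha' : a ≤ n := Nat.lt_succ_iff.1 (Finset.mem_range.1 ha)
  have h1 : (List.ofFn fun j : Fin n => b j.succ) =
      (List.ofFn fun j : Fin n => (OpTree.leaf j.succ : OpTree DendGen (Fin (n + 1)))).map
        (treeVal γ b) := by
    rw [List.map_ofFn]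
    rfl
  have h2 := treeVal_nearrowGt h b (ltSearrow (.leaf 0)
    ((List.ofFn fun j : Fin n => .leaf j.succ).drop a))
    ((List.ofFn fun j : Fin n => .leaf j.succ).take a)
  -- As `a` is at most `n`, the first piece has exactly `a` letters, so its sign is the one
  -- prescribed in the sum.
  rw [List.length_take, List.length_ofFn, min_eq_left ha', treeVal_ltSearrow h, List.map_take,
    List.map_drop, ← h1] at h2
  exact h2

end Trees

/-! ## The dendriform operad -/

section Dend

/-- The dendriform structure on the twisted algebra over an operad under `Dend`. -/
def Hom.dendAlg (f : Hom (DendOperad R) Q) (I : Type) [Finite I] : DendAlg R (TwistedAlg Q I) :=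
  twistedDendAlg (fun _ _ _ hr => f.freeHom_presentedGen hr) I

/-- The image of `psiCorolla` under a morphism acts on the twisted algebra by a brace. -/
theorem op_app_psiCorolla (f : Hom (DendOperad R) Q) (n : ℕ)
    (b : Fin (n + 1) → TwistedAlg Q I) :
    op (f.app _ (DendOperad.psiCorolla R n)) b =
      (f.dendAlg I).brace (b 0) (List.ofFn fun j : Fin n => b j.succ) := by
  rw [← opLin_apply, DendOperad.psiCorolla, map_sum, map_sum, Hom.dendAlg, ← sum_treeVal_psiTree]
  refine Finset.sum_congr rfl fun a _ => ?_
  rw [map_smul, map_smul, Hom.app_presentedOf, opLin_apply, op_evalLin]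

/-! ## The brace operad in the dendriform operad -/

/-- The values of the generators of `Brace` in `Dend`. -/
def braceGens (R : Type u) [CommRing R] : ∀ k, BraceGen k → (DendOperad R).Obj (Fin k)
  | _, .corolla n => DendOperad.psiCorolla R (n + 1)

theorem treeVal_brace (b : X → TwistedAlg (DendOperad R) I) (z : OpTree BraceGen X)
    (l : List (OpTree BraceGen X)) :
    treeVal (braceGens R) b (BraceGen.brace z l) =
      ((Hom.id (DendOperad R)).dendAlg I).brace (treeVal (braceGens R) b z)
        (l.map (treeVal (braceGens R) b)) := by
  cases l with
  | nil => exact (DendAlg.brace_nil _ _).symm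
  | cons a l =>
    refine (op_app_psiCorolla (Hom.id (DendOperad R)) _ _).trans ?_
    congr 1
    refine Eq.trans ?_ (congrArg (List.map (treeVal (braceGens R) b)) (List.ofFn_get (a :: l)))
    rw [List.map_ofFn]
    rfl

theorem treeVal_lhs (n m : ℕ) (b : BraceGen.Label n m → TwistedAlg (DendOperad R) I) :
    treeVal (braceGens R) b (BraceGen.lhs n m) =
      ((Hom.id (DendOperad R)).dendAlg I).brace
        (((Hom.id (DendOperad R)).dendAlg I).brace (b (.inl ()))
          (List.ofFn fun i => b (.inr (.inl i)))) (List.ofFn fun j => b (.inr (.inr j))) := by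
  rw [BraceGen.lhs, treeVal_brace, treeVal_brace, List.map_ofFn, List.map_ofFn]
  rfl

theorem treeVal_rhs (n m : ℕ) (b : BraceGen.Label n m → TwistedAlg (DendOperad R) I)
    (f : Fin m → Fin (2 * n + 1)) :
    treeVal (braceGens R) b (BraceGen.rhs n m f) =
      ((Hom.id (DendOperad R)).dendAlg I).brace (b (.inl ()))
        (((Hom.id (DendOperad R)).dendAlg I).interleave (List.ofFn fun i => b (.inr (.inl i)))
          (blocks f fun j => b (.inr (.inr j)))) := by
  have h : ∀ k, (BraceGen.block n m f k).map (treeVal (braceGens R) b) =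
      ((List.finRange m).filter fun j => (f j : ℕ) = k).map fun j => b (.inr (.inr j)) := by
    intro k
    rw [BraceGen.block, List.map_map]
    rfl
  have h1 := ((Hom.id (DendOperad R)).dendAlg I).interleave_ofFn
    (fun i : Fin n => b (.inr (.inl i)))
    fun k => ((List.finRange m).filter fun j => (f j : ℕ) = k).map fun j => b (.inr (.inr j))
  rw [BraceGen.rhs, treeVal_brace, List.map_append, List.map_flatMap]
  simp only [List.map_cons, treeVal_brace, h]
  simp only [blocks, Fin.ext_iff]
  exact congrArg _ h1.symm

theorem freeHom_braceGens (I : Type) [Finite I] (r : (freeOperad R BraceGen).Obj I)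
    (hr : BraceRel R I r) : (freeHom (braceGens R)).app I r = 0 := by
  obtain ⟨n, m, -, -⟩ := hr
  refine freeHom_eq_zero ?_
  rw [map_sub, map_sub, map_sum, map_sum, sub_eq_zero]
  simp only [opLin_freeHom_freeOf, treeVal_lhs, treeVal_rhs]
  rw [DendAlg.brace_brace, DendAlg.sumShuffle_eq_sumPieces, List.length_ofFn,
    ← sum_blocks_eq_sumPieces]

/-- The morphism from `Brace` to `Dend`. -/
def psiHom (R : Type u) [CommRing R] : Hom (BraceOperad R) (DendOperad R) :=
  presentedLift (braceGens R) freeHom_braceGens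

theorem psiHom_corolla (n : ℕ) :
    (psiHom R).app (Fin (n + 2)) (BraceOperad.corolla R n) = DendOperad.psiCorolla R (n + 1) :=
  presentedLift_gen _ _ _

/-! ## The pre-Lie operad in the dendriform operad -/

/-- The operation `x₀ ≺ x₁ - x₁ ≻ x₀`. -/
def dendCirc (R : Type u) [CommRing R] : (DendOperad R).Obj (Fin 2) :=
  DendOperad.prec R - (DendOperad R).map (Equiv.swap 0 1) (DendOperad.succ R)

theorem binOp_app_dendCirc (f : Hom (DendOperad R) Q) (a b : TwistedAlg Q I) :
    binOp (f.app (Fin 2) (dendCirc R)) a b = (f.dendAlg I).lt a b - (f.dendAlg I).gt b a := by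
  rw [dendCirc, map_sub, f.app_map, binOp_sub, binOp_swap]
  rfl

/-- The dendriform axioms turn the associator of x, y, z into x ≺ (y ≻ z + z ≻ y) - y ≻ (x ≺ z) - z
≻ (x ≺ y) + (y ≺ z + z ≺ y) ≻ x, which is symmetric in y and z. -/
theorem freeHom_dendCirc (I : Type) [Finite I] (r : (freeOperad R OneBinary).Obj I)
    (hr : PreLieRel R I r) : (freeHom (binaryGen (dendCirc R))).app I r = 0 := by
  obtain ⟨⟩ := hr
  refine freeHom_eq_zero ?_
  have h := fun a b : TwistedAlg (DendOperad R) (Fin 3) =>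
    binOp_app_dendCirc (Hom.id (DendOperad R)) a b
  have h' : (Hom.id (DendOperad R)).app (Fin 2) (dendCirc R) = dendCirc R := rfl
  rw [h'] at h
  simp only [map_sub, opLin_left, opLin_right, h, LinearMap.sub_apply, DendAlg.lt_lt, DendAlg.lt_gt,
    DendAlg.gt_gt]
  abel

/-- The morphism from `PreLie` to `Dend`. -/
def alphaHom (R : Type u) [CommRing R] : Hom (PreLieOperad R) (DendOperad R) :=
  presentedLift (binaryGen (dendCirc R)) freeHom_dendCirc

theorem alphaHom_circ : (alphaHom R).app (Fin 2) (PreLieOperad.circ R) = dendCirc R :=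
  presentedLift_gen _ _ _

/-- The first brace is the pre-Lie product, so every ideal containing the image of the braces
contains the generator of the ideal of α. -/
theorem psiCorolla_one : DendOperad.psiCorolla R 1 = dendCirc R := by
  refine eq_of_op_gen_eq ?_
  refine (op_app_psiCorolla (Hom.id (DendOperad R)) 1 _).trans ?_
  rw [op_eq_binOp]
  refine Eq.trans ?_ (binOp_app_dendCirc (Hom.id (DendOperad R)) _ _).symm
  simp [DendAlg.brace, sumSplit_cons, sumSplit_nil, DendAlg.coword, DendAlg.word,
    DendAlg.lact_apply, DendAlg.ract_apply, sub_eq_add_neg]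

end Dend

end SymOperad

namespace SymOperad

variable {R : Type u} [CommRing R]

/-! ## The Zinbiel operad as a quotient of the dendriform operad -/

theorem zin_relation {I : Type} [Finite I] (a b c : TwistedAlg (ZinOperad R) I) :
    binOp (ZinOperad.mul R) (binOp (ZinOperad.mul R) a b) c =
      binOp (ZinOperad.mul R) a (binOp (ZinOperad.mul R) b c) +
        binOp (ZinOperad.mul R) a (binOp (ZinOperad.mul R) c b) := by
  have hγ : (fun k g => (Hom.id (ZinOperad R)).app (Fin k) (presentedGen (ZinRel R) g)) =
      binaryGen (ZinOperad.mul R) := by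
    funext k g
    cases g
    rfl
  have h := (Hom.id (ZinOperad R)).freeHom_presentedGen ZinRel.zin
  rw [hγ] at h
  have h1 := opLin_freeHom_eq_zero h ![a, b, c]
  simp only [map_sub, map_add, opLin_left, opLin_right] at h1
  exact sub_eq_zero.1 h1

theorem freeHom_zinGens (I : Type) [Finite I] (r : (freeOperad R DendGen).Obj I)
    (hr : DendRel R I r) :
    (freeHom (dendGens (ZinOperad.mul R)
      ((ZinOperad R).map (Equiv.swap 0 1) (ZinOperad.mul R)))).app I r = 0 := by
  obtain ⟨⟩ | ⟨⟩ | ⟨⟩ := hr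
  all_goals
    refine freeHom_eq_zero ?_
    simp only [map_sub, map_add, opLin_freeHom_freeOf, treeVal_lt, treeVal_gt, treeVal, dendGens,
      binOp_swap, zin_relation]
    abel

/-- The morphism from `Dend` to `Zin`. -/
def dendToZin (R : Type u) [CommRing R] : Hom (DendOperad R) (ZinOperad R) :=
  presentedLift (dendGens (ZinOperad.mul R)
    ((ZinOperad R).map (Equiv.swap 0 1) (ZinOperad.mul R))) freeHom_zinGens

theorem dendToZin_prec : (dendToZin R).app (Fin 2) (DendOperad.prec R) = ZinOperad.mul R :=
  presentedLift_gen _ _ _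

theorem dendToZin_succ : (dendToZin R).app (Fin 2) (DendOperad.succ R) =
    (ZinOperad R).map (Equiv.swap 0 1) (ZinOperad.mul R) :=
  presentedLift_gen _ _ _

theorem dendToZin_dendCirc : (dendToZin R).app (Fin 2) (dendCirc R) = 0 := by
  rw [dendCirc, map_sub, Hom.app_map, dendToZin_prec, dendToZin_succ, sub_eq_zero]
  exact ((ZinOperad R).map_symm_map (Equiv.swap 0 1) (ZinOperad.mul R)).symm

/-! ### Quotients of Dend in which ≻ is the opposite of ≺ -/

section Quotient

variable {T : OpIdeal (DendOperad R)}

theorem dendAlg_quotHom_gt (hT : dendCirc R ∈ T.carrier (Fin 2)) {I : Type}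
    [Finite I] (a b : TwistedAlg ((DendOperad R).quot T) I) :
    ((quotHom T).dendAlg I).gt a b = ((quotHom T).dendAlg I).lt b a := by
  have h := binOp_app_dendCirc (quotHom T) b a
  rw [quotHom_apply, (quotMk_eq_zero T _).2 hT] at h
  exact (sub_eq_zero.1 (h.symm.trans (map_zero (opLin ![b, a])))).symm

/-- In the quotient this operation acts by a brace with a nonempty list, in a dendriform algebra
where ≻ is the opposite of ≺. Such a brace is zero, and the action is faithful. -/
theorem psiCorolla_mem (hT : dendCirc R ∈ T.carrier (Fin 2)) (n : ℕ) :
    DendOperad.psiCorolla R (n + 1) ∈ T.carrier (Fin (n + 2)) := by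
  refine (quotMk_eq_zero T _).1 (eq_of_op_gen_eq ?_)
  refine (op_app_psiCorolla (quotHom T) (n + 1) _).trans ?_
  rw [DendAlg.brace_eq_zero _ (dendAlg_quotHom_gt hT) _ (by simp)]
  exact (map_zero (opLin _)).symm

theorem freeHom_quotMk_prec (hT : dendCirc R ∈ T.carrier (Fin 2)) (I : Type)
    [Finite I] (r : (freeOperad R OneBinary).Obj I)
    (hr : ZinRel R I r) :
    (freeHom (binaryGen (quotMk T (DendOperad.prec R)))).app I r = 0 := by
  obtain ⟨⟩ := hr
  refine freeHom_eq_zero ?_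
  simp only [map_sub, map_add, opLin_left, opLin_right]
  rw [sub_eq_zero]
  -- The first dendriform axiom becomes the Zinbiel relation once y ≻ z is replaced by z ≺ y.
  refine (((quotHom T).dendAlg _).lt_lt _ _ _).trans ?_
  rw [dendAlg_quotHom_gt hT]
  rfl

/-- The morphism from `Zin` to a quotient of `Dend`. -/
def zinToQuot (hT : dendCirc R ∈ T.carrier (Fin 2)) :
    Hom (ZinOperad R) ((DendOperad R).quot T) :=
  presentedLift (binaryGen (quotMk T (DendOperad.prec R))) (freeHom_quotMk_prec hT)

theorem zinToQuot_mul (hT : dendCirc R ∈ T.carrier (Fin 2)) :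
    (zinToQuot hT).app (Fin 2) (ZinOperad.mul R) = quotMk T (DendOperad.prec R) :=
  presentedLift_gen _ _ _

theorem map_swap_quotMk_prec (hT : dendCirc R ∈ T.carrier (Fin 2)) :
    ((DendOperad R).quot T).map (Equiv.swap 0 1) (quotMk T (DendOperad.prec R)) =
      quotMk T (DendOperad.succ R) := by
  refine eq_of_op_gen_eq ?_
  rw [op_eq_binOp, op_eq_binOp, binOp_swap]
  exact (dendAlg_quotHom_gt hT _ _).symm

end Quotient

theorem dend_quot_hom_ext {T : OpIdeal (DendOperad R)} {Q : SymOperad.{u, w} R}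
    {f g : Hom ((DendOperad R).quot T) Q}
    (h₁ : f.app (Fin 2) (quotMk T (DendOperad.prec R)) =
      g.app (Fin 2) (quotMk T (DendOperad.prec R)))
    (h₂ : f.app (Fin 2) (quotMk T (DendOperad.succ R)) =
      g.app (Fin 2) (quotMk T (DendOperad.succ R))) : f = g := by
  refine quot_hom_ext (presented_hom_ext fun k x => ?_)
  cases x
  · exact h₁
  · exact h₂

/-- An isomorphism is determined by its underlying morphism. -/
theorem Iso.ext_hom {P : SymOperad.{u, v} R} {Q : SymOperad.{u, w} R} {e e' : Iso P Q}
    (h : e.hom = e'.hom) : e = e' := by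
  refine Iso.ext h (Hom.ext ?_)
  funext I _
  refine LinearMap.ext fun q => ?_
  -- Uniqueness of inverses: both inverses applied to `q` equal the second inverse of the common
  -- morphism applied to the first inverse of `q`.
  rw [← e'.inv_hom I (e.inv.app I q), ← h, e.hom_inv]

/-- The isomorphism between `Zin` and the quotient of `Dend` by an ideal that contains
`x₀ ≺ x₁ - x₁ ≻ x₀` and on which the morphism to `Zin` vanishes. -/
def zinIso {T : OpIdeal (DendOperad R)} (hT : dendCirc R ∈ T.carrier (Fin 2))
    (hT' : ∀ (I : Type) [Finite I], T.carrier I ≤ (dendToZin R).ker.carrier I) :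
    Iso ((DendOperad R).quot T) (ZinOperad R) where
  hom := quotLift T (dendToZin R) hT'
  inv := zinToQuot hT
  inv_hom I _ p := by
    have h : (quotLift T (dendToZin R) hT').trans (zinToQuot hT) = Hom.id _ := by
      refine dend_quot_hom_ext ?_ ?_
      · refine (congrArg ((zinToQuot hT).app (Fin 2)) dendToZin_prec).trans ?_
        exact zinToQuot_mul hT
      · refine (congrArg ((zinToQuot hT).app (Fin 2)) dendToZin_succ).trans ?_
        rw [Hom.app_map, zinToQuot_mul]
        exact map_swap_quotMk_prec hT
    exact congrArg (fun f : Hom _ _ => f.app I p) h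
  hom_inv I _ q := by
    have h : (zinToQuot hT).trans (quotLift T (dendToZin R) hT') = Hom.id _ := by
      refine presented_hom_ext fun k x => ?_
      cases x
      exact (congrArg _ (zinToQuot_mul hT)).trans dendToZin_prec
    exact congrArg (fun f : Hom _ _ => f.app I q) h

end SymOperad

end

/-! ### The proposition -/

theorem mainTheorem10 (R : Type u) [CommRing R] :
    (∃! α : SymOperad.Hom (PreLieOperad R) (DendOperad R),
      α.app (Fin 2) (PreLieOperad.circ R) =
        DendOperad.prec R - (DendOperad R).map (Equiv.swap 0 1) (DendOperad.succ R)) ∧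
    (∃! ψ : SymOperad.Hom (BraceOperad R) (DendOperad R),
      ∀ n : ℕ, ψ.app (Fin (n + 2)) (BraceOperad.corolla R n) =
        DendOperad.psiCorolla R (n + 1)) ∧
    ∀ (α : SymOperad.Hom (PreLieOperad R) (DendOperad R))
      (ψ : SymOperad.Hom (BraceOperad R) (DendOperad R)),
      α.app (Fin 2) (PreLieOperad.circ R) =
        DendOperad.prec R - (DendOperad R).map (Equiv.swap 0 1) (DendOperad.succ R) →
      (∀ n : ℕ, ψ.app (Fin (n + 2)) (BraceOperad.corolla R n) =
        DendOperad.psiCorolla R (n + 1)) →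
      α.plusIdeal = ψ.plusIdeal ∧
      ∃! e : SymOperad.Iso ((DendOperad R).quot α.plusIdeal) (ZinOperad R),
        e.hom.app (Fin 2) (SymOperad.quotMk α.plusIdeal (DendOperad.prec R)) = ZinOperad.mul R ∧
        e.hom.app (Fin 2) (SymOperad.quotMk α.plusIdeal (DendOperad.succ R)) =
          (ZinOperad R).map (Equiv.swap 0 1) (ZinOperad.mul R) := by
  refine ⟨⟨SymOperad.alphaHom R, SymOperad.alphaHom_circ, fun f hf =>
      SymOperad.presented_hom_ext fun k x => ?_⟩,
    ⟨SymOperad.psiHom R, SymOperad.psiHom_corolla, fun f hf =>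
      SymOperad.presented_hom_ext fun k x => ?_⟩,
    fun α ψ hα hψ => ?_⟩
  · cases x
    exact hf.trans SymOperad.alphaHom_circ.symm
  · obtain ⟨n⟩ := x
    exact (hf n).trans (SymOperad.psiHom_corolla n).symm
  · have hα_mem : SymOperad.dendCirc R ∈ α.plusIdeal.carrier (Fin 2) :=
      (congrArg (· ∈ α.plusIdeal.carrier (Fin 2)) hα).mp
        (α.mem_plusIdeal (by simp) (PreLieOperad.circ R))
    -- The corolla with index 0 has two inputs, so it is the binary brace.
    have hψ_mem : SymOperad.dendCirc R ∈ ψ.plusIdeal.carrier (Fin 2) := by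
      rw [← SymOperad.psiCorolla_one, ← hψ 0]
      exact ψ.mem_plusIdeal (by simp) (BraceOperad.corolla R 0)
    -- Minimality of the ideal of α, used twice: with the ideal of ψ for one inclusion, and with the
    -- kernel of the morphism to Zin so that this morphism descends to the quotient.
    have hα_le (T : SymOperad.OpIdeal (DendOperad R))
        (hT : SymOperad.dendCirc R ∈ T.carrier (Fin 2)) (I : Type) [Finite I] :
        α.plusIdeal.carrier I ≤ T.carrier I := by
      refine SymOperad.Hom.plusIdeal_le (fun k g => ?_) I
      cases g
      exact (congrArg (· ∈ T.carrier (Fin 2)) hα).mpr hT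
    refine ⟨SymOperad.OpIdeal.ext (funext fun I => funext fun _ =>
      le_antisymm (hα_le _ hψ_mem I) ?_), ?_⟩
    · refine SymOperad.Hom.plusIdeal_le (fun k g => ?_) I
      obtain ⟨n⟩ := g
      exact (congrArg (· ∈ α.plusIdeal.carrier (Fin (n + 2))) (hψ n)).mpr
        (SymOperad.psiCorolla_mem hα_mem n)
    · refine ⟨SymOperad.zinIso hα_mem (hα_le _ (LinearMap.mem_ker.2 SymOperad.dendToZin_dendCirc)),
        ⟨SymOperad.dendToZin_prec, SymOperad.dendToZin_succ⟩, fun e he =>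
          SymOperad.Iso.ext_hom (SymOperad.dend_quot_hom_ext ?_ ?_)⟩
      · exact he.1.trans SymOperad.dendToZin_prec.symm
      · exact he.2.trans SymOperad.dendToZin_succ.symm
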